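/- Let $\tau\in\mathbb C$ with $\operatorname{Im}\tau>0$, let $k\ge 1$ be an integer, $\nu\in\mathbb C$, and let $P\in\mathbb C[X]$ be a polynomial of degree $<k$. Let $C=\mathbb C/(\mathbb Z+\tau\mathbb Z)$, and on the germ $(\mathbb C_x\times\mathbb C_y,\{y=0\})$ consider the commuting holomorphic vector fields $$v_0=\frac{y^{k+1}}{1+\nu y^k}\,\partial_y+\tau\,\frac{y^kP(1/y)}{1+\nu y^k}\,\partial_x,\qquad v_\infty=\tau\,\partial_x .$$ Let $(U_{k,\nu,P},C)$ be the quotient of $(\mathbb C_x\times\mathbb C_y,\{y=0\})$ by the group $\Gamma$ generated by $\phi_1(x,y)=(x+1,y)$ and $\phi_\tau=\exp(v_0+v_\infty)$. (With $z=e^{2i\pi x}$ and $q=e^{2i\pi\tau}$ this is the quotient of $(\mathbb C_z^*\times\mathbb C_y,\{y=0\})$ by $\exp(v_0+v_\infty)$, with $\partial_x=2i\pi z\partial_z$, and $C=\mathbb C^*_z/\langle z\mapsto qz\rangle$.) Let $\mathrm{Aut}(U_{k,\nu,P},C)$ be the group of formal automorphisms of $(U_{k,\nu,P},C)$ along $C$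 that induce a translation on $C$. Explicitly, it consists of the formal diffeomorphisms of $(\mathbb C_x\times\mathbb C_y,\{y=0\})$, with components in $\mathcal O(\mathbb C_x)[[y]]$, which normalize $\Gamma$ and induce a translation on $C$, modulo $\Gamma$. Such an automorphism is called convergent if the components of its lifts are Taylor expansions along $\{y=0\}$ of functions holomorphic on a neighbourhood of $\{y=0\}$. Let $n=k$ if $P$ is constant; otherwise let $n=\gcd(k,d_P)$, where $d_P$ is the largest positive integer $d$ such that $P(\zeta X)=P(X)$ for every $\zeta\in\mathbb C$ with $\zeta^d=1$. Then: 1. every element of $\mathrm{Aut}(U_{k,\nu,P},C)$ is convergent; 2. $n$ divides $k$, and there is a group isomorphism $\mathrm{Aut}(U_{k,\nu,P},C)\simeq \mathbb Z/n\times(\mathbb C^*\times\mathbb C^*)$; 3. this isomorphism can be chosen so that each one-parameter subgroup $t\mapsto(e^{at},e^{bt})$, $a,b\in\mathbb C$, of the factor $\mathbb C^*\times\mathbb C^*$ acts as the flow of a unique formal vector field, and the set of these vector fields (the Lie algebra of the infinitesimal action of $\mathbb C^*\times\mathbb C^*$) is the complex vector space spanned by $v_0$ and $v_\infty$. -/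

import Mathlib

/-!
The elliptic curve is `C = ℂ / (ℤ + τ ℤ)` with `0 < Im τ` and universal covering coordinate `x`
(so `z = exp (2 π i x)`).  The neighbourhood `(U, C)` attached to `(k, ν, P)` is the quotient of
the germ `(ℂ_x × ℂ_y, {y = 0})` by the group generated by `φ₁ (x, y) = (x + 1, y)` and
`φ_τ = exp (v₀ + v_∞)`.

Formal maps of `(ℂ_x × ℂ_y, {y = 0})` are handled through pull-back on the ring `O(ℂ)⟦y⟧` of formal
functions along `{y = 0}`: a formal diffeomorphism `Φ = (α, β)` is the `ℂ`-algebra automorphism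
`f ↦ f ∘ Φ`, with components `α = Φ^* x` and `β = Φ^* y`.
-/

noncomputable section

namespace EllipticNbhd

open Polynomial PowerSeries

/-- The ring `O(ℂ)` of entire functions. -/
def Entire : Subalgebra ℂ (ℂ → ℂ) where
  carrier := {f | Differentiable ℂ f}
  mul_mem' := fun hf hg => Differentiable.mul hf hg
  add_mem' := fun hf hg => Differentiable.add hf hg
  algebraMap_mem' := fun c => differentiable_const c

/-- The ring `O(ℂ_x)⟦y⟧` of formal functions along the curve `{y = 0}` in `ℂ_x × ℂ_y`. -/
abbrev FormalFun : Type := PowerSeries Entire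

/-- The coefficient of `y ^ n` of a formal function, as a function of `x`. -/
def cf (n : ℕ) (f : FormalFun) : ℂ → ℂ := (PowerSeries.coeff n f : Entire)

/-- The coordinate function `x`. -/
def coordX : FormalFun := PowerSeries.C (⟨fun x => x, differentiable_id⟩ : Entire)

/-- The coordinate function `y`. -/
def coordY : FormalFun := PowerSeries.X

/-- The value of a formal function at the point `(p, 0)` of the curve `{y = 0}`. -/
def evalAt (p : ℂ) : FormalFun →ₐ[ℂ] ℂ where
  toFun f := cf 0 f p
  map_one' := by simp [cf]
  map_mul' f g := by simp [cf]
  map_zero' := by simp [cf]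
  map_add' f g := by simp [cf]
  commutes' c := by simp [cf, PowerSeries.algebraMap_apply]

/-- Every `ℂ`-algebra homomorphism from formal functions to `ℂ` is the evaluation at a point of
`{y = 0}`. -/
theorem exists_eq_evalAt (χ : FormalFun →ₐ[ℂ] ℂ) : ∃ p : ℂ, ∀ f, χ f = evalAt p f := by
  have hX : χ PowerSeries.X = 0 := by
    by_contra hs
    have hu : IsUnit ((PowerSeries.X : FormalFun) - algebraMap ℂ FormalFun (χ PowerSeries.X)) := by
      rw [PowerSeries.isUnit_iff_constantCoeff]
      have : PowerSeries.constantCoeff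
          ((PowerSeries.X : FormalFun) - algebraMap ℂ FormalFun (χ PowerSeries.X))
          = algebraMap ℂ Entire (-(χ PowerSeries.X)) := by
        simp [PowerSeries.algebraMap_apply]
      rw [this]
      exact (IsUnit.mk0 _ (neg_ne_zero.mpr hs)).map _
    have h2 := hu.map χ
    simp at h2
  refine ⟨χ coordX, fun f => ?_⟩
  set a : ℂ := χ coordX with ha
  set f₀ : Entire := PowerSeries.constantCoeff f with hf₀
  have hg : Differentiable ℂ (dslope (f₀ : ℂ → ℂ) a) := by
    have h0 : Differentiable ℂ (f₀ : ℂ → ℂ) := f₀.2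
    have h1 : DifferentiableOn ℂ (dslope (f₀ : ℂ → ℂ) a) Set.univ :=
      (Complex.differentiableOn_dslope Filter.univ_mem).2 h0.differentiableOn
    exact differentiableOn_univ.1 h1
  set g : Entire := ⟨dslope (f₀ : ℂ → ℂ) a, hg⟩ with hgdef
  have key : f = algebraMap ℂ FormalFun ((f₀ : ℂ → ℂ) a)
      + (coordX - algebraMap ℂ FormalFun a) * PowerSeries.C g
      + PowerSeries.X * PowerSeries.mk fun n => PowerSeries.coeff (n + 1) f := by
    have h1 := PowerSeries.eq_X_mul_shift_add_const f
    have h2 : (PowerSeries.C f₀ : FormalFun) = algebraMap ℂ FormalFun ((f₀ : ℂ → ℂ) a)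
        + (coordX - algebraMap ℂ FormalFun a) * PowerSeries.C g := by
      simp only [coordX, PowerSeries.algebraMap_apply, ← map_sub, ← map_mul, ← map_add]
      congr 1
      apply Subtype.ext
      funext x
      have := sub_smul_dslope (f₀ : ℂ → ℂ) a x
      simp only [smul_eq_mul] at this
      change (f₀ : ℂ → ℂ) x = (f₀ : ℂ → ℂ) a + (x - a) * dslope (f₀ : ℂ → ℂ) a x
      rw [this]; ring
    rw [← h2, add_comm]
    exact h1
  have h3 : evalAt a f = (f₀ : ℂ → ℂ) a := by
    simp [evalAt, cf, hf₀]
  rw [h3]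
  conv_lhs => rw [key]
  have h4 : ∀ c : ℂ, χ (algebraMap ℂ FormalFun c) = c := fun c => by simp
  rw [map_add, map_add, map_mul, map_mul, map_sub, h4, h4, hX, ← ha]
  ring

/-! ### Vector fields -/

/-- The derivation `∂_x` of `O(ℂ)`. -/
def entireDeriv : Derivation ℂ Entire Entire where
  toFun f := ⟨deriv f, Differentiable.deriv f.2⟩
  map_add' f g := by
    apply Subtype.ext; funext x
    exact deriv_add (f.2 x) (g.2 x)
  map_smul' c f := by
    apply Subtype.ext; funext x
    exact deriv_const_smul c (f.2 x)
  map_one_eq_zero' := by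
    apply Subtype.ext; funext x
    exact deriv_const x 1
  leibniz' f g := by
    apply Subtype.ext; funext x
    have := deriv_mul (f.2 x) (g.2 x)
    simp only [smul_eq_mul]
    refine this.trans ?_
    change _ = (f : ℂ → ℂ) x * deriv g x + (g : ℂ → ℂ) x * deriv f x
    ring

/-- The vector field `∂_x`, acting coefficientwise. -/
def partialX : Derivation ℂ FormalFun FormalFun where
  toFun f := PowerSeries.mk fun n => entireDeriv (PowerSeries.coeff n f)
  map_add' f g := by ext1 n; simp
  map_smul' c f := by ext1 n; simp
  map_one_eq_zero' := by
    ext1 n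
    simp only [LinearMap.coe_mk, AddHom.coe_mk, PowerSeries.coeff_mk, PowerSeries.coeff_one]
    split_ifs <;> simp
  leibniz' f g := by
    ext1 n
    simp only [LinearMap.coe_mk, AddHom.coe_mk, PowerSeries.coeff_mk, smul_eq_mul, map_add,
      PowerSeries.coeff_mul, map_sum, Derivation.leibniz, Finset.sum_add_distrib]
    congr 1
    exact (Finset.Nat.sum_antidiagonal_swap
      (f := fun p : ℕ × ℕ => PowerSeries.coeff p.2 g * entireDeriv (PowerSeries.coeff p.1 f))).symm

/-- The vector field `∂_y`. -/
def partialY : Derivation ℂ FormalFun FormalFun :=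
  (PowerSeries.derivative Entire).restrictScalars ℂ

/-- A formal function of `y` alone, seen as a formal function of `(x, y)`. -/
def ofY : PowerSeries ℂ →+* FormalFun := PowerSeries.map (algebraMap ℂ Entire)

/-- The data `(τ, k, ν, P)` of a normal form: `Im τ > 0`, `k > 0`, `ν ∈ ℂ`, and `P` a polynomial of
degree less than `k`. -/
structure NormalForm where
  τ : ℂ
  k : ℕ
  ν : ℂ
  P : ℂ[X]
  im_pos : 0 < τ.im
  k_pos : 0 < k
  degree_lt : P.degree < k

namespace NormalForm

variable (M : NormalForm)

/-- The series `1 / (1 + ν y ^ k)`. -/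
def unitSeries : PowerSeries ℂ := (1 + PowerSeries.C M.ν * PowerSeries.X ^ M.k)⁻¹

/-- The polynomial `y ^ k * P (1 / y)`. -/
def reflected : PowerSeries ℂ := (M.P.reflect M.k : ℂ[X])

/-- The vector field
`v₀ = y ^ (k + 1) / (1 + ν y ^ k) ∂_y + τ y ^ k P (1 / y) / (1 + ν y ^ k) ∂_x`. -/
def v₀ : Derivation ℂ FormalFun FormalFun :=
  ofY (PowerSeries.X ^ (M.k + 1) * M.unitSeries) • partialY
    + ofY (PowerSeries.C M.τ * M.reflected * M.unitSeries) • partialX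

/-- The vector field `v_∞ = τ ∂_x` (that is `2 π i τ z ∂_z`). -/
def vInf : Derivation ℂ FormalFun FormalFun := M.τ • partialX

end NormalForm

/-! ### Exponentials of vector fields -/

/-- `E` strictly raises the order in `y`. -/
def RaisesOrder (E : Derivation ℂ FormalFun FormalFun) : Prop :=
  ∀ (n : ℕ) (f : FormalFun), PowerSeries.X ^ n ∣ f → PowerSeries.X ^ (n + 1) ∣ E f

/-- The Lie series `exp (E) f = ∑ E ^ m f / m!`; the sum is finite in each degree in `y` when `E`
strictly raises the order in `y`. -/
def lieSeries (E : Derivation ℂ FormalFun FormalFun) (f : FormalFun) : FormalFun :=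
  PowerSeries.mk fun n => PowerSeries.coeff n
    (∑ m ∈ Finset.range (n + 1), ((m.factorial : ℂ)⁻¹) • (E^[m] f))

namespace RaisesOrder

variable {E : Derivation ℂ FormalFun FormalFun}

theorem smul (hE : RaisesOrder E) (s : ℂ) : RaisesOrder (s • E) := fun n f hf => by
  obtain ⟨g, hg⟩ := hE n f hf
  exact ⟨s • g, by rw [Derivation.smul_apply, hg, mul_smul_comm]⟩

theorem iterate_dvd (hE : RaisesOrder E) (m n : ℕ) (f : FormalFun)
    (hf : PowerSeries.X ^ n ∣ f) : PowerSeries.X ^ (n + m) ∣ E^[m] f := by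
  induction m with
  | zero => simpa using hf
  | succ m ih =>
    rw [Function.iterate_succ_apply', ← add_assoc]
    exact hE _ _ ih

theorem coeff_iterate (hE : RaisesOrder E) {m n : ℕ} (h : n < m) (f : FormalFun) :
    PowerSeries.coeff n (E^[m] f) = 0 := by
  have := hE.iterate_dvd m 0 f (by simp)
  rw [zero_add, PowerSeries.X_pow_dvd_iff] at this
  exact this n h

theorem coeff_lieSeries (hE : RaisesOrder E) {n N : ℕ} (h : n < N) (f : FormalFun) :
    PowerSeries.coeff n (lieSeries E f) = PowerSeries.coeff n
      (∑ m ∈ Finset.range N, ((m.factorial : ℂ)⁻¹) • (E^[m] f)) := by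
  rw [lieSeries, PowerSeries.coeff_mk, map_sum, map_sum]
  refine Finset.sum_subset (by intro a; simp only [Finset.mem_range]; omega) ?_
  intro m _ hm
  have hnm : n < m := by simp only [Finset.mem_range] at hm; omega
  have : PowerSeries.coeff n (((m.factorial : ℂ)⁻¹) • (E^[m] f))
      = ((m.factorial : ℂ)⁻¹) • PowerSeries.coeff n (E^[m] f) := rfl
  rw [this, hE.coeff_iterate hnm, smul_zero]

end RaisesOrder

/-- The term `E ^ m f / m!` of the Lie series. -/
def lieTerm (E : Derivation ℂ FormalFun FormalFun) (m : ℕ) (f : FormalFun) : FormalFun :=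
  ((m.factorial : ℂ)⁻¹) • (E^[m] f)

theorem apply_lieTerm (E : Derivation ℂ FormalFun FormalFun) (m : ℕ) (f : FormalFun) :
    E (lieTerm E m f) = ((m : ℂ) + 1) • lieTerm E (m + 1) f := by
  have h : ((m : ℂ) + 1) ≠ 0 := Nat.cast_add_one_ne_zero m
  have h' : (m.factorial : ℂ) ≠ 0 := Nat.cast_ne_zero.2 m.factorial_ne_zero
  rw [lieTerm, lieTerm, Derivation.map_smul, Function.iterate_succ_apply', smul_smul]
  congr 1
  rw [Nat.factorial_succ]
  push_cast
  field_simp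

theorem lieTerm_mul (E : Derivation ℂ FormalFun FormalFun) (m : ℕ) (f g : FormalFun) :
    lieTerm E m (f * g) =
      ∑ p ∈ Finset.HasAntidiagonal.antidiagonal m, lieTerm E p.1 f * lieTerm E p.2 g := by
  induction m with
  | zero => simp [lieTerm]
  | succ m ih =>
    have h : ((m : ℂ) + 1) ≠ 0 := Nat.cast_add_one_ne_zero m
    have h1 : ((m : ℂ) + 1) • lieTerm E (m + 1) (f * g) = ((m : ℂ) + 1) •
        ∑ p ∈ Finset.HasAntidiagonal.antidiagonal (m + 1),
          lieTerm E p.1 f * lieTerm E p.2 g := by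
      rw [← apply_lieTerm, ih, map_sum]
      have h2 : ∀ p ∈ Finset.HasAntidiagonal.antidiagonal (m + 1),
          ((m : ℂ) + 1) • (lieTerm E p.1 f * lieTerm E p.2 g)
            = (p.1 : ℂ) • (lieTerm E p.1 f * lieTerm E p.2 g)
              + (p.2 : ℂ) • (lieTerm E p.1 f * lieTerm E p.2 g) := by
        intro p hp
        rw [Finset.HasAntidiagonal.mem_antidiagonal] at hp
        rw [← add_smul]
        congr 1
        exact_mod_cast hp.symm
      rw [Finset.smul_sum, Finset.sum_congr rfl h2, Finset.sum_add_distrib,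
        Finset.Nat.sum_antidiagonal_succ, Finset.Nat.sum_antidiagonal_succ'
          (f := fun p : ℕ × ℕ => (p.2 : ℂ) • (lieTerm E p.1 f * lieTerm E p.2 g))]
      simp only [Nat.cast_zero, zero_smul, zero_add]
      rw [← Finset.sum_add_distrib]
      refine Finset.sum_congr rfl fun p _ => ?_
      rw [Derivation.leibniz, apply_lieTerm, apply_lieTerm]
      simp only [smul_eq_mul, Nat.cast_add, Nat.cast_one, mul_smul_comm]
      rw [add_comm, mul_comm (lieTerm E p.2 g)]
    exact smul_right_injective _ h h1

theorem sum_antidiagonal_eq_sum_product {V : Type*} [AddCommMonoid V] (N : ℕ) (a : ℕ × ℕ → V)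
    (ha : ∀ p, N ≤ p.1 + p.2 → a p = 0) :
    ∑ m ∈ Finset.range N, ∑ p ∈ Finset.HasAntidiagonal.antidiagonal m, a p
      = ∑ i ∈ Finset.range N, ∑ j ∈ Finset.range N, a (i, j) := by
  rw [← Finset.sum_product']
  have h1 : ∑ p ∈ Finset.range N ×ˢ Finset.range N, a p
      = ∑ p ∈ (Finset.range N ×ˢ Finset.range N).filter (fun p => p.1 + p.2 < N), a p := by
    symm
    refine Finset.sum_subset (Finset.filter_subset _ _) ?_
    intro p hp hp'
    apply ha
    by_contra hlt
    exact hp' (Finset.mem_filter.2 ⟨hp, by omega⟩)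
  rw [h1]
  have h2 := Finset.sum_fiberwise_of_maps_to
    (s := (Finset.range N ×ˢ Finset.range N).filter (fun p => p.1 + p.2 < N))
    (t := Finset.range N) (g := fun p => p.1 + p.2)
    (fun p hp => Finset.mem_range.2 (Finset.mem_filter.1 hp).2) a
  rw [← h2]
  refine Finset.sum_congr rfl fun m hm => Finset.sum_congr ?_ fun _ _ => rfl
  ext p
  simp only [Finset.HasAntidiagonal.mem_antidiagonal, Finset.mem_filter, Finset.mem_product, Finset.mem_range]
    at hm ⊢
  omega

namespace RaisesOrder

variable {E : Derivation ℂ FormalFun FormalFun}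

theorem lieTerm_dvd (hE : RaisesOrder E) (m n : ℕ) (f : FormalFun)
    (hf : PowerSeries.X ^ n ∣ f) : PowerSeries.X ^ (n + m) ∣ lieTerm E m f := by
  obtain ⟨g, hg⟩ := hE.iterate_dvd m n f hf
  exact ⟨((m.factorial : ℂ)⁻¹) • g, by rw [lieTerm, hg, mul_smul_comm]⟩

theorem lieSeries_mul (hE : RaisesOrder E) (f g : FormalFun) :
    lieSeries E (f * g) = lieSeries E f * lieSeries E g := by
  ext1 n
  have hl : PowerSeries.coeff n (lieSeries E f * lieSeries E g) = PowerSeries.coeff n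
      ((∑ i ∈ Finset.range (n + 1), lieTerm E i f)
        * ∑ j ∈ Finset.range (n + 1), lieTerm E j g) := by
    rw [PowerSeries.coeff_mul, PowerSeries.coeff_mul]
    refine Finset.sum_congr rfl fun p hp => ?_
    rw [Finset.HasAntidiagonal.mem_antidiagonal] at hp
    rw [hE.coeff_lieSeries (N := n + 1) (by omega), hE.coeff_lieSeries (N := n + 1) (by omega)]
    rfl
  rw [hl, hE.coeff_lieSeries (Nat.lt_succ_self n), Finset.sum_mul_sum]
  have h1 : ∀ m, ((m.factorial : ℂ)⁻¹) • (E^[m] (f * g)) = lieTerm E m (f * g) := fun _ => rfl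
  simp only [h1, lieTerm_mul, map_sum]
  refine sum_antidiagonal_eq_sum_product (n + 1)
    (fun p => PowerSeries.coeff n (lieTerm E p.1 f * lieTerm E p.2 g)) ?_
  intro p hp
  have hd : (PowerSeries.X : FormalFun) ^ (p.1 + p.2) ∣ lieTerm E p.1 f * lieTerm E p.2 g := by
    rw [pow_add]
    refine mul_dvd_mul ?_ ?_
    · simpa using hE.lieTerm_dvd p.1 0 f (by simp)
    · simpa using hE.lieTerm_dvd p.2 0 g (by simp)
  exact PowerSeries.X_pow_dvd_iff.1 hd n (by omega)

theorem lieSeries_add (E : Derivation ℂ FormalFun FormalFun) (f g : FormalFun) :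
    lieSeries E (f + g) = lieSeries E f + lieSeries E g := by
  ext1 n
  have h : ∀ m, E^[m] (f + g) = E^[m] f + E^[m] g := fun m =>
    iterate_map_add E m f g
  simp only [lieSeries, PowerSeries.coeff_mk, h, smul_add, Finset.sum_add_distrib, map_add]

theorem lieSeries_algebraMap (E : Derivation ℂ FormalFun FormalFun) (c : ℂ) :
    lieSeries E (algebraMap ℂ FormalFun c) = algebraMap ℂ FormalFun c := by
  ext1 n
  have h : ∀ m, E^[m + 1] (algebraMap ℂ FormalFun c) = 0 := fun m => by
    rw [Function.iterate_succ_apply, Derivation.map_algebraMap]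
    exact iterate_map_zero E m
  rw [lieSeries, PowerSeries.coeff_mk, Finset.sum_range_succ']
  simp [h]

/-- `exp ((s + t) E) = exp (s E) ∘ exp (t E)`. -/
theorem lieSeries_add_smul (hE : RaisesOrder E) (s t : ℂ) (f : FormalFun) :
    lieSeries ((s + t) • E) f = lieSeries (s • E) (lieSeries (t • E) f) := by
  have hit : ∀ (c : ℂ) (m : ℕ) (h : FormalFun), (c • E)^[m] h = c ^ m • E^[m] h := by
    intro c m h
    induction m with
    | zero => simp
    | succ m ih =>
      rw [Function.iterate_succ_apply', ih, Derivation.smul_apply, Derivation.map_smul,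
        Function.iterate_succ_apply', smul_smul, pow_succ']
  ext1 n
  have hsm : ∀ (c : ℂ) (h : FormalFun),
      PowerSeries.coeff n (c • h) = c • PowerSeries.coeff n h := fun _ _ => rfl
  have hdiff : (PowerSeries.X : FormalFun) ^ (n + 1) ∣ lieSeries (t • E) f
      - ∑ j ∈ Finset.range (n + 1), lieTerm (t • E) j f := by
    rw [PowerSeries.X_pow_dvd_iff]
    intro i hi
    rw [map_sub, (hE.smul t).coeff_lieSeries hi]
    exact sub_self _
  have hterm : ∀ m, PowerSeries.coeff n (lieTerm (s • E) m (lieSeries (t • E) f))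
      = ∑ j ∈ Finset.range (n + 1),
        PowerSeries.coeff n (lieTerm (s • E) m (lieTerm (t • E) j f)) := by
    intro m
    have h1 := (hE.smul s).lieTerm_dvd m _ _ hdiff
    have h2 := PowerSeries.X_pow_dvd_iff.1 h1 n (by omega)
    have hsub : ∀ g h : FormalFun, lieTerm (s • E) m (g - h)
        = lieTerm (s • E) m g - lieTerm (s • E) m h := fun g h => by
      simp only [lieTerm, iterate_map_sub, smul_sub]
    have hsum : lieTerm (s • E) m (∑ j ∈ Finset.range (n + 1), lieTerm (t • E) j f)
        = ∑ j ∈ Finset.range (n + 1), lieTerm (s • E) m (lieTerm (t • E) j f) := by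
      simp only [lieTerm]
      rw [← Finset.smul_sum]
      congr 1
      induction (Finset.range (n + 1)) using Finset.induction_on with
      | empty => exact iterate_map_zero (s • E) m
      | insert a S ha ih =>
        rw [Finset.sum_insert ha, Finset.sum_insert ha, iterate_map_add, ih]
    rw [hsub, map_sub, sub_eq_zero, hsum, map_sum] at h2
    exact h2
  rw [(hE.smul s).coeff_lieSeries (Nat.lt_succ_self n),
    (hE.smul (s + t)).coeff_lieSeries (Nat.lt_succ_self n), map_sum, map_sum]
  have h1 : ∀ (F : Derivation ℂ FormalFun FormalFun) (m : ℕ) (h : FormalFun),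
      ((m.factorial : ℂ)⁻¹) • (F^[m] h) = lieTerm F m h := fun _ _ _ => rfl
  simp only [h1, hterm]
  rw [← sum_antidiagonal_eq_sum_product (n + 1)
    (fun p => PowerSeries.coeff n (lieTerm (s • E) p.1 (lieTerm (t • E) p.2 f)))]
  · refine Finset.sum_congr rfl fun m _ => ?_
    have h2 : ∀ p ∈ Finset.HasAntidiagonal.antidiagonal m,
        PowerSeries.coeff n (lieTerm (s • E) p.1 (lieTerm (t • E) p.2 f))
          = ((m.factorial : ℂ)⁻¹ * (m.choose p.1 * (s ^ p.1 * t ^ p.2)))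
            • PowerSeries.coeff n (E^[m] f) := by
      intro p hp
      rw [Finset.HasAntidiagonal.mem_antidiagonal] at hp
      have hmap : ∀ (c : ℂ) (i : ℕ) (h : FormalFun), E^[i] (c • h) = c • E^[i] h := by
        intro c i h
        induction i with
        | zero => rfl
        | succ i ih => rw [Function.iterate_succ_apply', ih, Derivation.map_smul,
            Function.iterate_succ_apply']
      simp only [lieTerm, hit, hmap, hsm, smul_smul]
      rw [← Function.iterate_add_apply, hp]
      congr 1
      have hc : (m.choose p.1 : ℂ) * p.1.factorial * p.2.factorial = m.factorial := by
        have := Nat.add_choose_mul_factorial_mul_factorial p.1 p.2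
        rw [hp, Nat.choose_symm_of_eq_add (by omega : m = p.2 + p.1)] at this
        exact_mod_cast this
      have f1 : (p.1.factorial : ℂ) ≠ 0 := Nat.cast_ne_zero.2 p.1.factorial_ne_zero
      have f2 : (p.2.factorial : ℂ) ≠ 0 := Nat.cast_ne_zero.2 p.2.factorial_ne_zero
      have f3 : (m.factorial : ℂ) ≠ 0 := Nat.cast_ne_zero.2 m.factorial_ne_zero
      field_simp
      rw [← hc]
      ring
    rw [Finset.sum_congr rfl h2, ← Finset.sum_smul, ← Finset.mul_sum]
    simp only [lieTerm, hit, hsm, smul_smul]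
    congr 2
    rw [(Commute.all s t).add_pow']
    simp [nsmul_eq_mul]
  · intro p hp
    have hd := (hE.smul s).lieTerm_dvd p.1 p.2 _
      (by simpa using (hE.smul t).lieTerm_dvd p.2 0 f (by simp))
    exact PowerSeries.X_pow_dvd_iff.1 hd n (by omega)

theorem lieSeries_zero (f : FormalFun) :
    lieSeries (0 : Derivation ℂ FormalFun FormalFun) f = f := by
  ext1 n
  have h : ∀ m, (⇑(0 : Derivation ℂ FormalFun FormalFun))^[m + 1] f = 0 := fun m => by
    rw [Function.iterate_succ_apply']; rfl
  rw [lieSeries, PowerSeries.coeff_mk, Finset.sum_range_succ']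
  simp only [h, smul_zero, Finset.sum_const_zero, zero_add]
  simp

/-- The exponential of `E` as an automorphism of the ring of formal functions: the pull-back by the
time one map of the flow of `E`. -/
def exp (hE : RaisesOrder E) : FormalFun ≃ₐ[ℂ] FormalFun where
  toFun := lieSeries E
  invFun := lieSeries ((-1 : ℂ) • E)
  left_inv f := by
    have := hE.lieSeries_add_smul (-1) 1 f
    simpa [lieSeries_zero] using this.symm
  right_inv f := by
    have := hE.lieSeries_add_smul 1 (-1) f
    simpa [lieSeries_zero] using this.symm
  map_mul' := hE.lieSeries_mul
  map_add' := lieSeries_add E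
  commutes' := lieSeries_algebraMap E

end RaisesOrder

/-- Pull-back by the translation `(x, y) ↦ (x + c, y)`, on functions of `x`. -/
def entireShift (c : ℂ) : Entire →ₐ[ℂ] Entire where
  toFun f := ⟨fun x => (f : ℂ → ℂ) (x + c),
    (show Differentiable ℂ (f : ℂ → ℂ) from f.2).comp (differentiable_id.add_const c)⟩
  map_one' := rfl
  map_mul' _ _ := rfl
  map_zero' := rfl
  map_add' _ _ := rfl
  commutes' _ := rfl

/-- Pull-back by the translation `(x, y) ↦ (x + c, y)`, i.e. by the time `c` map of the flow of
`∂_x`. -/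
def shift (c : ℂ) : FormalFun ≃ₐ[ℂ] FormalFun where
  toFun f := PowerSeries.map (entireShift c).toRingHom f
  invFun f := PowerSeries.map (entireShift (-c)).toRingHom f
  left_inv f := by
    ext1 n
    apply Subtype.ext
    funext x
    rw [PowerSeries.coeff_map, PowerSeries.coeff_map]
    change ((PowerSeries.coeff n f : Entire) : ℂ → ℂ) (x + -c + c) =
      ((PowerSeries.coeff n f : Entire) : ℂ → ℂ) x
    rw [neg_add_cancel_right]
  right_inv f := by
    ext1 n
    apply Subtype.ext
    funext x
    rw [PowerSeries.coeff_map, PowerSeries.coeff_map]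
    change ((PowerSeries.coeff n f : Entire) : ℂ → ℂ) (x + c + -c) =
      ((PowerSeries.coeff n f : Entire) : ℂ → ℂ) x
    rw [add_neg_cancel_right]
  map_mul' f g := map_mul _ f g
  map_add' f g := map_add _ f g
  commutes' c := by
    ext1 n
    simp [PowerSeries.algebraMap_apply, PowerSeries.coeff_C]

namespace NormalForm

variable (M : NormalForm)

theorem v₀_raisesOrder : RaisesOrder M.v₀ := by
  intro n f hf
  have hrefl : (PowerSeries.X : PowerSeries ℂ) ∣ M.reflected := by
    rw [PowerSeries.X_dvd_iff, reflected, ← PowerSeries.coeff_zero_eq_constantCoeff_apply,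
      Polynomial.coeff_coe, Polynomial.coeff_reflect]
    simp only [Polynomial.revAt_zero]
    exact Polynomial.coeff_eq_zero_of_degree_lt M.degree_lt
  have hX : ofY PowerSeries.X = (PowerSeries.X : FormalFun) := by simp [ofY]
  have h1 : (PowerSeries.X : FormalFun) ^ (n + 1) ∣
      ofY (PowerSeries.X ^ (M.k + 1) * M.unitSeries) * partialY f := by
    obtain ⟨g, rfl⟩ := hf
    have hd : partialY (PowerSeries.X ^ n * g) = PowerSeries.X ^ n * partialY g
        + g * ((n : FormalFun) * PowerSeries.X ^ (n - 1)) := by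
      simp [partialY, Derivation.leibniz, Derivation.leibniz_pow]
    have hk := M.k_pos
    rw [hd, map_mul, map_pow, hX, mul_assoc, mul_add, mul_add]
    refine dvd_add ?_ ?_
    · refine ⟨PowerSeries.X ^ M.k * (ofY M.unitSeries * partialY g), by ring⟩
    · rcases n with _ | n
      · simp
      · obtain ⟨k, hk⟩ : ∃ k, M.k = k + 1 := ⟨M.k - 1, by omega⟩
        refine ⟨PowerSeries.X ^ k * (ofY M.unitSeries * (g * ((n + 1 : ℕ) : FormalFun))), ?_⟩
        rw [hk, Nat.add_sub_cancel]
        ring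
  have h2 : (PowerSeries.X : FormalFun) ^ (n + 1) ∣
      ofY (PowerSeries.C M.τ * M.reflected * M.unitSeries) * partialX f := by
    obtain ⟨r, hr⟩ := hrefl
    have h3 : (PowerSeries.X : FormalFun) ^ n ∣ partialX f := by
      rw [PowerSeries.X_pow_dvd_iff] at hf ⊢
      intro m hm
      change PowerSeries.coeff m (PowerSeries.mk fun n => entireDeriv (PowerSeries.coeff n f)) = 0
      rw [PowerSeries.coeff_mk, hf m hm, map_zero]
    obtain ⟨g, hg⟩ := h3
    refine ⟨ofY (PowerSeries.C M.τ * r * M.unitSeries) * g, ?_⟩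
    rw [hg, hr]
    simp only [map_mul, hX]
    ring
  exact dvd_add h1 h2

/-- Pull-back by the deck transformation `φ₁ (x, y) = (x + 1, y)`. -/
def deckOne : FormalFun ≃ₐ[ℂ] FormalFun := shift 1

/-- Pull-back by the deck transformation `φ_τ = exp (v₀ + v_∞)`. Since `v₀` and `v_∞ = τ ∂_x`
commute, it is the composite of `exp v₀` and of the translation `exp v_∞` by `τ`. -/
def deckTau : FormalFun ≃ₐ[ℂ] FormalFun := M.v₀_raisesOrder.exp * shift M.τ

/-- The group of deck transformations, generated by `φ₁` and `φ_τ`. -/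
def deckGroup : Subgroup (FormalFun ≃ₐ[ℂ] FormalFun) :=
  Subgroup.closure {deckOne, M.deckTau}

/-- The lattice `ℤ + τ ℤ`. -/
def lattice : AddSubgroup ℂ := AddSubgroup.closure {1, M.τ}

/-- The elliptic curve `C = ℂ / (ℤ + τ ℤ)`. -/
abbrev Curve : Type := ℂ ⧸ M.lattice

/-- The formal diffeomorphism with pull-back `σ` preserves `{y = 0}` and covers there a translation
of `C`: for some `c ∈ C`, every `(p, 0)` is mapped to a point `(p', 0)` with `p' = p + c` in `C`. -/
def InducesTranslation (σ : FormalFun ≃ₐ[ℂ] FormalFun) : Prop :=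
  ∃ c : M.Curve, ∀ p : ℂ, ∃ p' : ℂ, (p' : M.Curve) = (p : M.Curve) + c ∧
    ∀ f : FormalFun, evalAt p (σ f) = evalAt p' f

/-- The formal diffeomorphisms of `(ℂ_x × ℂ_y, {y = 0})` which descend to the quotient `(U, C)` by
the deck transformations and induce there a translation on `C`. -/
def lifts : Subgroup (FormalFun ≃ₐ[ℂ] FormalFun) where
  carrier := {σ | σ ∈ Subgroup.normalizer (M.deckGroup : Set (FormalFun ≃ₐ[ℂ] FormalFun)) ∧
    M.InducesTranslation σ}
  one_mem' := ⟨one_mem _, 0, fun p => ⟨p, by simp, fun f => rfl⟩⟩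
  mul_mem' := by
    rintro σ ρ ⟨hσ, c, hc⟩ ⟨hρ, d, hd⟩
    refine ⟨mul_mem hσ hρ, c + d, fun p => ?_⟩
    obtain ⟨p', hp', h1⟩ := hc p
    obtain ⟨p'', hp'', h2⟩ := hd p'
    refine ⟨p'', by rw [hp'', hp', add_assoc], fun f => ?_⟩
    rw [AlgEquiv.mul_apply, h1, h2]
  inv_mem' := by
    rintro σ ⟨hσ, c, hc⟩
    refine ⟨inv_mem hσ, -c, fun p => ?_⟩
    obtain ⟨p', h1⟩ := exists_eq_evalAt ((evalAt p).comp (σ⁻¹ : FormalFun ≃ₐ[ℂ] FormalFun))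
    obtain ⟨p'', hp'', h2⟩ := hc p'
    have h3 : p = p'' := by
      have h4 := h2 coordX
      rw [← h1] at h4
      simpa [evalAt, cf, coordX] using h4
    refine ⟨p', ?_, h1⟩
    rw [h3, hp'', add_neg_cancel_right]

theorem evalAt_deckOne (p : ℂ) (f : FormalFun) : evalAt p (deckOne f) = evalAt (p + 1) f := by
  change cf 0 (PowerSeries.map (entireShift 1).toRingHom f) p = cf 0 f (p + 1)
  rw [cf, PowerSeries.coeff_map]
  rfl

theorem evalAt_deckTau (p : ℂ) (f : FormalFun) :
    evalAt p (M.deckTau f) = evalAt (p + M.τ) f := by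
  change cf 0 (lieSeries M.v₀ (PowerSeries.map (entireShift M.τ).toRingHom f)) p
    = cf 0 f (p + M.τ)
  rw [cf, M.v₀_raisesOrder.coeff_lieSeries Nat.zero_lt_one]
  simp only [Finset.sum_range_one, Nat.factorial_zero, Nat.cast_one, inv_one, one_smul,
    Function.iterate_zero, id_eq]
  rw [PowerSeries.coeff_map]
  rfl

/-- Deck transformations are lifts (of the identity). -/
theorem deckGroup_le_lifts : M.deckGroup ≤ M.lifts := by
  rw [deckGroup, Subgroup.closure_le]
  have hn := Subgroup.le_normalizer (H := M.deckGroup)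
  rintro σ (rfl | rfl)
  · refine ⟨hn (Subgroup.subset_closure (by simp)), 0, fun p => ⟨p + 1, ?_, evalAt_deckOne p⟩⟩
    rw [add_zero, QuotientAddGroup.eq]
    have : -(p + 1) + p = -1 := by ring
    rw [this]
    exact neg_mem (AddSubgroup.subset_closure (by simp))
  · refine ⟨hn (Subgroup.subset_closure (by simp)), 0,
      fun p => ⟨p + M.τ, ?_, M.evalAt_deckTau p⟩⟩
    rw [add_zero, QuotientAddGroup.eq]
    have : -(p + M.τ) + p = -M.τ := by ring
    rw [this]
    exact neg_mem (AddSubgroup.subset_closure (by simp))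

/-- The group `Aut (U, C)` of formal automorphisms of `(U, C)` inducing a translation on `C`:
lifts to the universal covering modulo deck transformations. (The product is the composition of
pull-backs, so this is the opposite of the group of formal maps under composition, which is
isomorphic to it by inversion.) -/
abbrev Aut : Type := M.lifts ⧸ M.deckGroup.subgroupOf M.lifts

instance : (M.deckGroup.subgroupOf M.lifts).Normal :=
  Subgroup.normal_subgroupOf_of_le_normalizer fun _ h => h.1

end NormalForm

/-! ### Convergence -/

/-- A formal function converges if it is the Taylor expansion along `{y = 0}` of a holomorphic
function on an open neighbourhood of `{y = 0}` in `ℂ_x × ℂ_y`. -/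
def Converges (f : FormalFun) : Prop :=
  ∃ (W : Set (ℂ × ℂ)) (h : ℂ × ℂ → ℂ), IsOpen W ∧ (∀ x : ℂ, (x, 0) ∈ W) ∧
    DifferentiableOn ℂ h W ∧
    ∀ (x : ℂ) (n : ℕ), iteratedDeriv n (fun y => h (x, y)) 0 = n.factorial * cf n f x

/-- A formal diffeomorphism is convergent if both of its components are. -/
def ConvergentDiffeo (σ : FormalFun ≃ₐ[ℂ] FormalFun) : Prop :=
  Converges (σ coordX) ∧ Converges (σ coordY)

namespace NormalForm

variable (M : NormalForm)

/-- A formal automorphism of `(U, C)` is convergent if its lifts are. -/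
def Convergent (g : M.Aut) : Prop :=
  ∀ σ : M.lifts, (QuotientGroup.mk σ : M.Aut) = g → ConvergentDiffeo σ

/-! ### Infinitesimal generators -/

/-- The one-parameter family `γ` of automorphisms of `(U, C)` is the flow of the vector field `D`:
it lifts to a one-parameter group `θ` of formal diffeomorphisms with
`d/dt (f ∘ θ_t) = D f` at `t = 0` for every formal function `f`. -/
def IsFlowOf (γ : ℂ → M.Aut) (D : Derivation ℂ FormalFun FormalFun) : Prop :=
  ∃ θ : Multiplicative ℂ →* M.lifts,
    (∀ t : ℂ, (QuotientGroup.mk (θ (Multiplicative.ofAdd t)) : M.Aut) = γ t) ∧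
    ∀ (f : FormalFun) (n : ℕ) (x : ℂ),
      HasDerivAt
        (fun t : ℂ => cf n ((θ (Multiplicative.ofAdd t) : FormalFun ≃ₐ[ℂ] FormalFun) f) x)
        (cf n (D f) x) 0

/-- The one-parameter subgroup `t ↦ (exp (a t), exp (b t))` of `ℂ^* × ℂ^*`; the tangent vector
`(a, b)` at the identity is an arbitrary element of the Lie algebra `ℂ × ℂ`. -/
def oneParam (a b t : ℂ) : ℂˣ × ℂˣ :=
  (Units.mk0 (Complex.exp (a * t)) (Complex.exp_ne_zero _),
    Units.mk0 (Complex.exp (b * t)) (Complex.exp_ne_zero _))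

/-- The set of infinitesimal generators of an action of `ℂ^* × ℂ^*` on `(U, C)`. -/
def generators (ρ : ℂˣ × ℂˣ →* M.Aut) : Set (Derivation ℂ FormalFun FormalFun) :=
  {D | ∃ a b : ℂ, M.IsFlowOf (fun t => ρ (oneParam a b t)) D}

/-- The supremum `d_P` of the positive integers `d` such that `P (ζ X) = P (X)` for every `d`-th
root of unity `ζ` (meaningful when `P` is not constant). -/
def rotationOrder : ℕ :=
  sSup {d : ℕ | 0 < d ∧ ∀ ζ : ℂ, ζ ^ d = 1 → M.P.comp (Polynomial.C ζ * Polynomial.X) = M.P}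

/-- The integer `n = n (k, P)`: it is `k` if `P` is constant and `gcd (k, d_P)` otherwise. -/
def symmetryOrder : ℕ :=
  if M.P.natDegree = 0 then M.k else Nat.gcd M.k M.rotationOrder

end NormalForm

end EllipticNbhd

end

noncomputable section

namespace EllipticNbhd

open Polynomial PowerSeries

/-! ### Coefficients of formal functions -/

section Coefficients

variable (n : ℕ) (f g : FormalFun) (x : ℂ)

/-! A lift normalizes the deck group and covers a translation. The displacement along `{y = 0}` is
continuous with values in a coset of a countable lattice, hence constant. Comparing translation
parts, and using that 1 and τ are independent over ℤ, shows that a lift σ actually commutes with φ₁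
and φ_τ (`commute_flow_of_mem_lifts`).

Commutation makes σ independent of `x`. By induction on the order in `y`, the lowest coefficient of
`∂_x (σ^* y)`, and then of `∂_x (σ^* x - x)`, is an entire doubly periodic function, so a constant;
it is the derivative of a 1-periodic function, so it is zero (`X_pow_succ_dvd_partialX`). Hence `σ^*
y = B(y)` and `σ^* x = x + A(y)`. So σ commutes with all translations, therefore with `exp (n v₀)`
for every natural `n`, and therefore with `v₀`, because coefficients of `exp (t v₀)` are polynomial
in `t` (`map_v₀`).

Write `B = y V`. Commutation with `v₀` is a differential equation for `V`: its constant term `l`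
satisfies `l ^ k = 1`, and the equation kills the first nonconstant coefficient unless its index is
the resonant one, `k`. Composing with a suitable `exp (s v₀)` removes the coefficient of index `k`,
leaving `B = l y`. Commutation on `x` then forces `A` to be constant and `l` to preserve `y ^ k
P(1/y)` (`exists_eq_rot_mul_flow`). Lifts are thus uniquely rotations by such `l`, which form the
group of `n`-th roots of unity, composed with `exp (s v₀ + c ∂_x)`.

In the coordinates `(s, c) ∈ ℂ²` the deck group is the lattice spanned by `(0, 1)` and `(1, τ)`, and
`ℂ²` modulo it is `ℂ^* × ℂ^*` through `expHom`. Convergence follows from a geometric bound on the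
coefficients of the Lie series (`exists_geomBounded_lieSeries`). The generator of a one-parameter
subgroup is unique because two lifts of it differ by a homomorphism from the divisible group ℂ to a
free abelian group (`IsFlowOf.unique`). -/

theorem cf_add : cf n (f + g) x = cf n f x + cf n g x := rfl

theorem cf_sub : cf n (f - g) x = cf n f x - cf n g x := by
  simp [cf]

theorem cf_smul (c : ℂ) : cf n (c • f) x = c * cf n f x := rfl

theorem cf_zero_right : cf n (0 : FormalFun) x = 0 := rfl

theorem cf_zero_mul : cf 0 (f * g) x = cf 0 f x * cf 0 g x := by
  simp [cf]

theorem cf_sum {ι : Type*} (s : Finset ι) (F : ι → FormalFun) :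
    cf n (∑ i ∈ s, F i) x = ∑ i ∈ s, cf n (F i) x := by
  classical
  induction s using Finset.induction_on with
  | empty => rfl
  | insert a s ha ih => rw [Finset.sum_insert ha, Finset.sum_insert ha, cf_add, ih]

theorem cf_algebraMap (c : ℂ) :
    cf n (algebraMap ℂ FormalFun c) x = if n = 0 then c else 0 := by
  rw [cf, PowerSeries.algebraMap_apply, PowerSeries.coeff_C]
  split_ifs <;> rfl

theorem cf_zero_algebraMap (c : ℂ) : cf 0 (algebraMap ℂ FormalFun c) x = c := by
  rw [cf_algebraMap, if_pos rfl]

theorem cf_X_pow_mul (m : ℕ) : cf (n + m) (PowerSeries.X ^ m * f) x = cf n f x := by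
  rw [cf, PowerSeries.coeff_X_pow_mul, cf]

theorem cf_ofY (g : PowerSeries ℂ) : cf n (ofY g) x = PowerSeries.coeff n g := by
  rw [cf, ofY, PowerSeries.coeff_map]
  rfl

theorem cf_coordX : cf n coordX x = if n = 0 then x else 0 := by
  rw [cf, coordX, PowerSeries.coeff_C]
  split_ifs <;> rfl

theorem cf_partialX : cf n (partialX f) x = deriv (cf n f) x := by
  change cf n (PowerSeries.mk fun n => entireDeriv (PowerSeries.coeff n f)) x = _
  rw [cf, PowerSeries.coeff_mk]
  rfl

theorem cf_partialY : cf n (partialY f) x = (n + 1) * cf (n + 1) f x := by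
  change cf n (PowerSeries.derivative Entire f) x = _
  rw [cf, PowerSeries.coeff_derivative, cf, mul_comm]
  simp

theorem cf_shift (c : ℂ) : cf n (shift c f) x = cf n f (x + c) := by
  change cf n (PowerSeries.map (entireShift c).toRingHom f) x = _
  rw [cf, PowerSeries.coeff_map]
  rfl

theorem differentiable_cf : Differentiable ℂ (cf n f) :=
  (PowerSeries.coeff n f : Entire).2

end Coefficients

theorem ext_cf {f g : FormalFun} (h : ∀ n x, cf n f x = cf n g x) : f = g := by
  ext1 n
  apply Subtype.ext
  funext x
  exact h n x

theorem X_pow_dvd_iff_cf {N : ℕ} {f : FormalFun} :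
    PowerSeries.X ^ N ∣ f ↔ ∀ n < N, ∀ x, cf n f x = 0 := by
  rw [PowerSeries.X_pow_dvd_iff]
  refine forall₂_congr fun n _ => ⟨fun h x => ?_, fun h => ?_⟩
  · rw [cf, h]; rfl
  · apply Subtype.ext
    funext x
    exact h x

theorem eq_of_forall_X_pow_dvd_sub {f g : FormalFun}
    (h : ∀ n : ℕ, (PowerSeries.X : FormalFun) ^ n ∣ f - g) : f = g := by
  refine ext_cf fun n x => ?_
  have := X_pow_dvd_iff_cf.1 (h (n + 1)) n (Nat.lt_succ_self n) x
  rwa [cf_sub, sub_eq_zero] at this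

theorem ofY_X : ofY PowerSeries.X = (PowerSeries.X : FormalFun) := by
  simp [ofY]

theorem ofY_C (c : ℂ) : ofY (PowerSeries.C c) = algebraMap ℂ FormalFun c := by
  rw [ofY, PowerSeries.map_C, PowerSeries.algebraMap_apply]

theorem ofY_injective : Function.Injective ofY := fun f g h => by
  ext n
  rw [← cf_ofY n 0, h, cf_ofY]

/-! ### Endomorphisms of the ring of formal functions -/

/-- Hadamard's lemma at the point `(a, 0)`. -/
theorem exists_eq_add_mul_add_mul (f : FormalFun) (a : ℂ) : ∃ g h : FormalFun,
    f = algebraMap ℂ FormalFun (cf 0 f a) + (coordX - algebraMap ℂ FormalFun a) * g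
      + coordY * h := by
  set f₀ : Entire := PowerSeries.constantCoeff f with hf₀
  have hg : Differentiable ℂ (dslope (f₀ : ℂ → ℂ) a) := by
    have h0 : Differentiable ℂ (f₀ : ℂ → ℂ) := f₀.2
    exact differentiableOn_univ.1
      ((Complex.differentiableOn_dslope Filter.univ_mem).2 h0.differentiableOn)
  set g : Entire := ⟨dslope (f₀ : ℂ → ℂ) a, hg⟩ with hgdef
  refine ⟨PowerSeries.C g, PowerSeries.mk fun n => PowerSeries.coeff (n + 1) f, ?_⟩
  have h1 := PowerSeries.eq_X_mul_shift_add_const f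
  have h2 : (PowerSeries.C f₀ : FormalFun) = algebraMap ℂ FormalFun (cf 0 f a)
      + (coordX - algebraMap ℂ FormalFun a) * PowerSeries.C g := by
    simp only [coordX, PowerSeries.algebraMap_apply, ← map_sub, ← map_mul, ← map_add]
    congr 1
    apply Subtype.ext
    funext x
    have := sub_smul_dslope (f₀ : ℂ → ℂ) a x
    simp only [smul_eq_mul] at this
    have h3 : cf 0 f a = (f₀ : ℂ → ℂ) a := by simp [cf, hf₀]
    rw [h3]
    change (f₀ : ℂ → ℂ) x = (f₀ : ℂ → ℂ) a + (x - a) * dslope (f₀ : ℂ → ℂ) a x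
    rw [this]; ring
  rw [← h2, add_comm]
  exact h1

/-- Composing σ with evaluation at a point of `{y = 0}` gives a character of the ring, which is
again evaluation at a point of `{y = 0}`, where `y` vanishes. This makes every algebra endomorphism
continuous for the `y`-adic filtration. -/
theorem X_dvd_map_coordY (σ : FormalFun →ₐ[ℂ] FormalFun) : PowerSeries.X ∣ σ coordY := by
  rw [← pow_one (PowerSeries.X : FormalFun), X_pow_dvd_iff_cf]
  intro n hn p
  obtain rfl : n = 0 := by omega
  obtain ⟨p', hp'⟩ := exists_eq_evalAt ((evalAt p).comp σ)
  have := hp' coordY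
  simpa [evalAt, coordY, cf] using this

theorem X_pow_dvd_map (σ : FormalFun →ₐ[ℂ] FormalFun) {n : ℕ} {f : FormalFun}
    (h : PowerSeries.X ^ n ∣ f) : PowerSeries.X ^ n ∣ σ f := by
  obtain ⟨g, rfl⟩ := h
  rw [map_mul, map_pow]
  exact Dvd.dvd.mul_right (pow_dvd_pow_of_dvd (X_dvd_map_coordY σ) n) _

/-- An endomorphism of the ring of formal functions is determined by its two components. -/
theorem algHom_ext {σ ρ : FormalFun →ₐ[ℂ] FormalFun} (hx : σ coordX = ρ coordX)
    (hy : σ coordY = ρ coordY) : σ = ρ := by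
  have key : ∀ (n : ℕ) (f : FormalFun), (PowerSeries.X : FormalFun) ^ n ∣ σ f - ρ f := by
    intro n
    induction n with
    | zero => intro f; simp
    | succ n ih =>
      intro f
      rw [X_pow_dvd_iff_cf]
      intro m hm x
      -- Hadamard's lemma is used at the image of `(x, 0)`: there `σ^* x - a` vanishes to order zero
      -- in `y` at the chosen `x`, which gains the missing order.
      obtain ⟨g, h, hf⟩ := exists_eq_add_mul_add_mul f (cf 0 (σ coordX) x)
      have h1 : σ f - ρ f = (σ coordX - algebraMap ℂ FormalFun (cf 0 (σ coordX) x))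
          * (σ g - ρ g) + σ coordY * (σ h - ρ h) := by
        conv_lhs => rw [hf]
        simp only [map_add, map_mul, map_sub, AlgHom.commutes, ← hx, ← hy]
        ring
      obtain ⟨u, hu⟩ := ih g
      have h2 : (PowerSeries.X : FormalFun) ^ (n + 1) ∣ σ coordY * (σ h - ρ h) := by
        rw [pow_succ']
        exact mul_dvd_mul (X_dvd_map_coordY σ) (ih h)
      rw [h1, cf_add, X_pow_dvd_iff_cf.1 h2 m hm x, add_zero, hu, mul_left_comm]
      rcases Nat.lt_succ_iff_lt_or_eq.1 hm with hm | rfl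
      · exact X_pow_dvd_iff_cf.1 (dvd_mul_right _ _) m hm x
      · have := cf_X_pow_mul 0 ((σ coordX - algebraMap ℂ FormalFun (cf 0 (σ coordX) x)) * u) x m
        rw [zero_add] at this
        rw [this, cf_zero_mul, cf_sub, cf_zero_algebraMap, sub_self, zero_mul]
  ext1 f
  exact eq_of_forall_X_pow_dvd_sub fun n => key n f

theorem algEquiv_ext {σ ρ : FormalFun ≃ₐ[ℂ] FormalFun} (hx : σ coordX = ρ coordX)
    (hy : σ coordY = ρ coordY) : σ = ρ := by
  have := algHom_ext (σ := σ.toAlgHom) (ρ := ρ.toAlgHom) hx hy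
  ext1 f
  exact congrArg (fun φ : FormalFun →ₐ[ℂ] FormalFun => φ f) this

/-! ### Lie series -/

/-- A linear endomorphism of formal functions is filtered if it preserves the order in `y`. -/
def Filtered (L : FormalFun →ₗ[ℂ] FormalFun) : Prop :=
  ∀ (n : ℕ) (f : FormalFun), PowerSeries.X ^ n ∣ f → PowerSeries.X ^ n ∣ L f

theorem filtered_algHom (σ : FormalFun →ₐ[ℂ] FormalFun) : Filtered σ.toLinearMap :=
  fun _ _ h => X_pow_dvd_map σ h

theorem filtered_id : Filtered LinearMap.id := fun _ _ h => h

theorem filtered_partialX : Filtered (partialX : FormalFun →ₗ[ℂ] FormalFun) := fun n f h => by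
  rw [X_pow_dvd_iff_cf] at h ⊢
  intro m hm x
  change cf m (partialX f) x = 0
  rw [cf_partialX, show cf m f = fun _ => 0 from funext (h m hm), deriv_const]

namespace RaisesOrder

variable {E : Derivation ℂ FormalFun FormalFun}

theorem X_pow_dvd_lieSeries_sub (hE : RaisesOrder E) (N : ℕ) (f : FormalFun) :
    PowerSeries.X ^ N ∣ lieSeries E f - ∑ m ∈ Finset.range N, ((m.factorial : ℂ)⁻¹) • E^[m] f := by
  rw [PowerSeries.X_pow_dvd_iff]
  intro n hn
  rw [map_sub, hE.coeff_lieSeries hn, sub_self]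

theorem iterate_smul (E : Derivation ℂ FormalFun FormalFun) (t : ℂ) (m : ℕ) (f : FormalFun) :
    (t • E)^[m] f = t ^ m • E^[m] f := by
  induction m with
  | zero => simp
  | succ m ih =>
    rw [Function.iterate_succ_apply', ih, Derivation.smul_apply, Derivation.map_smul,
      Function.iterate_succ_apply', smul_smul, pow_succ']

/-- Each coefficient of `exp (t E) f` is a polynomial in `t`, and a filtered linear map preserves
this. Commutation with `E` and with its exponentials can then be compared coefficient by coefficient
in `t`. -/
theorem cf_map_lieSeries_smul (hE : RaisesOrder E) {L : FormalFun →ₗ[ℂ] FormalFun}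
    (hL : Filtered L) {n N : ℕ} (h : n < N) (t : ℂ) (f : FormalFun) (x : ℂ) :
    cf n (L (lieSeries (t • E) f)) x
      = ∑ m ∈ Finset.range N, t ^ m * ((m.factorial : ℂ)⁻¹ * cf n (L (E^[m] f)) x) := by
  have h1 := X_pow_dvd_iff_cf.1 (hL _ _ ((hE.smul t).X_pow_dvd_lieSeries_sub N f)) n h x
  rw [map_sub, cf_sub, sub_eq_zero] at h1
  rw [h1, map_sum, cf_sum]
  refine Finset.sum_congr rfl fun m _ => ?_
  rw [map_smul, iterate_smul, map_smul, cf_smul, cf_smul]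
  ring

theorem cf_lieSeries_smul (hE : RaisesOrder E) {n N : ℕ} (h : n < N) (t : ℂ) (f : FormalFun)
    (x : ℂ) : cf n (lieSeries (t • E) f) x
      = ∑ m ∈ Finset.range N, t ^ m * ((m.factorial : ℂ)⁻¹ * cf n (E^[m] f) x) :=
  hE.cf_map_lieSeries_smul filtered_id h t f x

theorem map_iterate {L : FormalFun →ₗ[ℂ] FormalFun} (hc : ∀ f, L (E f) = E (L f)) (m : ℕ)
    (f : FormalFun) : L (E^[m] f) = E^[m] (L f) := by
  induction m with
  | zero => rfl
  | succ m ih => rw [Function.iterate_succ_apply', hc, ih, Function.iterate_succ_apply']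

/-- A filtered linear map which commutes with `E` commutes with `exp (t E)`. -/
theorem map_lieSeries_smul (hE : RaisesOrder E) {L : FormalFun →ₗ[ℂ] FormalFun}
    (hL : Filtered L) (hc : ∀ f, L (E f) = E (L f)) (t : ℂ) (f : FormalFun) :
    L (lieSeries (t • E) f) = lieSeries (t • E) (L f) := by
  refine ext_cf fun n x => ?_
  rw [hE.cf_map_lieSeries_smul hL (Nat.lt_succ_self n),
    hE.cf_lieSeries_smul (Nat.lt_succ_self n)]
  simp only [map_iterate hc]

/-- A filtered linear map which commutes with `exp (n E)` for every natural number `n` commutes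
with `E`. -/
theorem map_apply_of_map_lieSeries (hE : RaisesOrder E) {L : FormalFun →ₗ[ℂ] FormalFun}
    (hL : Filtered L)
    (hc : ∀ (n : ℕ) f, L (lieSeries ((n : ℂ) • E) f) = lieSeries ((n : ℂ) • E) (L f))
    (f : FormalFun) : L (E f) = E (L f) := by
  refine ext_cf fun n x => ?_
  -- With `n + 2` terms the linear term in `t` is present even when `n = 0`.
  have hN : n < n + 2 := by omega
  let p : ℂ[X] := ∑ m ∈ Finset.range (n + 2),
    Polynomial.monomial m ((m.factorial : ℂ)⁻¹ * cf n (L (E^[m] f)) x)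
  let q : ℂ[X] := ∑ m ∈ Finset.range (n + 2),
    Polynomial.monomial m ((m.factorial : ℂ)⁻¹ * cf n (E^[m] (L f)) x)
  have heval : ∀ i : ℕ, p.eval (i : ℂ) = q.eval (i : ℂ) := by
    intro i
    have h1 := hE.cf_map_lieSeries_smul hL hN i f x
    have h2 := hE.cf_lieSeries_smul hN i (L f) x
    rw [hc, h2] at h1
    simp only [p, q, Polynomial.eval_finsetSum, Polynomial.eval_monomial]
    simpa only [mul_comm] using h1.symm
  -- Two polynomials in `t` which agree at all natural numbers coincide; their coefficients of
  -- degree one are the two sides of the goal.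
  have hpq : p = q := Polynomial.eq_of_infinite_eval_eq _ _ <|
    (Set.infinite_range_of_injective (Nat.cast_injective (R := ℂ))).mono (by
      rintro _ ⟨i, rfl⟩
      exact heval i)
  have h1 : p.coeff 1 = q.coeff 1 := by rw [hpq]
  simpa [p, q, Polynomial.finsetSum_coeff, Polynomial.coeff_monomial] using h1

end RaisesOrder

/-! ### Translations and rotations -/

theorem shift_ofY (c : ℂ) (g : PowerSeries ℂ) : shift c (ofY g) = ofY g :=
  ext_cf fun n x => by rw [cf_shift, cf_ofY, cf_ofY]

theorem shift_coordX (c : ℂ) : shift c coordX = coordX + algebraMap ℂ FormalFun c :=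
  ext_cf fun n x => by
    rw [cf_shift, cf_add, cf_coordX, cf_coordX, cf_algebraMap]
    split_ifs <;> simp

theorem coordY_eq_ofY : coordY = ofY PowerSeries.X := ofY_X.symm

theorem shift_coordY (c : ℂ) : shift c coordY = coordY := by
  rw [coordY_eq_ofY, shift_ofY]

theorem shift_zero : shift 0 = 1 :=
  algEquiv_ext (by rw [shift_coordX, map_zero, add_zero]; rfl) (shift_coordY 0)

theorem shift_add (c d : ℂ) : shift (c + d) = shift c * shift d :=
  algEquiv_ext
    (by rw [AlgEquiv.mul_apply, shift_coordX, shift_coordX, map_add, map_add, shift_coordX,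
          AlgEquiv.commutes, add_assoc])
    (by rw [AlgEquiv.mul_apply, shift_coordY, shift_coordY, shift_coordY])

theorem shift_partialY (c : ℂ) (f : FormalFun) :
    shift c (partialY f) = partialY (shift c f) :=
  ext_cf fun n x => by rw [cf_shift, cf_partialY, cf_partialY, cf_shift]

theorem shift_partialX (c : ℂ) (f : FormalFun) :
    shift c (partialX f) = partialX (shift c f) :=
  ext_cf fun n x => by
    rw [cf_shift, cf_partialX, cf_partialX, funext fun x => cf_shift n f x c,
      deriv_comp_add_const]

/-- Pull-back by the rotation `(x, y) ↦ (x, l y)`. -/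
def rot (l : ℂˣ) : FormalFun ≃ₐ[ℂ] FormalFun where
  toFun f := PowerSeries.rescale (algebraMap ℂ Entire l) f
  invFun f := PowerSeries.rescale (algebraMap ℂ Entire (l⁻¹ : ℂˣ)) f
  left_inv f := by
    have h := PowerSeries.rescale_mul (algebraMap ℂ Entire l) (algebraMap ℂ Entire (l⁻¹ : ℂˣ))
    rw [← map_mul, Units.mul_inv, map_one, PowerSeries.rescale_one] at h
    exact (RingHom.congr_fun h f).symm
  right_inv f := by
    have h := PowerSeries.rescale_mul (algebraMap ℂ Entire (l⁻¹ : ℂˣ)) (algebraMap ℂ Entire l)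
    rw [← map_mul, Units.inv_mul, map_one, PowerSeries.rescale_one] at h
    exact (RingHom.congr_fun h f).symm
  map_mul' f g := map_mul _ f g
  map_add' f g := map_add _ f g
  commutes' c := by
    ext1 n
    rw [PowerSeries.coeff_rescale, PowerSeries.algebraMap_apply, PowerSeries.coeff_C]
    split_ifs with h <;> simp [h]

theorem cf_rot (l : ℂˣ) (n : ℕ) (f : FormalFun) (x : ℂ) :
    cf n (rot l f) x = (l : ℂ) ^ n * cf n f x := by
  change cf n (PowerSeries.rescale (algebraMap ℂ Entire l) f) x = _
  rw [cf, PowerSeries.coeff_rescale, ← map_pow]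
  rfl

theorem rot_ofY (l : ℂˣ) (g : PowerSeries ℂ) :
    rot l (ofY g) = ofY (PowerSeries.rescale (l : ℂ) g) :=
  ext_cf fun n x => by rw [cf_rot, cf_ofY, cf_ofY, PowerSeries.coeff_rescale]

theorem rescale_C (l c : ℂ) :
    PowerSeries.rescale l (PowerSeries.C c) = PowerSeries.C c := by
  ext n
  rw [PowerSeries.coeff_rescale, PowerSeries.coeff_C]
  split_ifs with h <;> simp [h]

theorem rot_coordX (l : ℂˣ) : rot l coordX = coordX :=
  ext_cf fun n x => by
    rw [cf_rot, cf_coordX]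
    split_ifs with h <;> simp [h]

theorem rot_coordY (l : ℂˣ) : rot l coordY = (l : ℂ) • coordY :=
  ext_cf fun n x => by
    rw [coordY_eq_ofY, cf_rot, cf_smul, cf_ofY, PowerSeries.coeff_X]
    split_ifs with h <;> simp [h]

theorem rot_mul (l m : ℂˣ) : rot (l * m) = rot l * rot m :=
  algEquiv_ext (by rw [AlgEquiv.mul_apply, rot_coordX, rot_coordX, rot_coordX])
    (by rw [AlgEquiv.mul_apply, rot_coordY, rot_coordY, map_smul, rot_coordY, smul_smul,
          Units.val_mul, mul_comm])

theorem rot_partialX (l : ℂˣ) (f : FormalFun) : rot l (partialX f) = partialX (rot l f) :=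
  ext_cf fun n x => by
    rw [cf_rot, cf_partialX, cf_partialX, funext fun x => cf_rot l n f x,
      deriv_const_mul_field]

theorem rot_partialY (l : ℂˣ) (f : FormalFun) :
    (l : ℂ) • rot l (partialY f) = partialY (rot l f) :=
  ext_cf fun n x => by
    rw [cf_smul, cf_rot, cf_partialY, cf_partialY, cf_rot]
    ring

theorem shift_mul_rot (c : ℂ) (l : ℂˣ) : shift c * rot l = rot l * shift c :=
  algEquiv_ext
    (by rw [AlgEquiv.mul_apply, AlgEquiv.mul_apply, rot_coordX, shift_coordX, map_add,
          rot_coordX, AlgEquiv.commutes])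
    (by rw [AlgEquiv.mul_apply, AlgEquiv.mul_apply, rot_coordY, shift_coordY, map_smul,
          shift_coordY, rot_coordY])

theorem partialX_ofY (g : PowerSeries ℂ) : partialX (ofY g) = 0 :=
  ext_cf fun n x => by
    rw [cf_partialX, funext fun x => cf_ofY n x g, deriv_const, cf_zero_right]

theorem partialY_ofY (g : PowerSeries ℂ) :
    partialY (ofY g) = ofY (PowerSeries.derivative ℂ g) :=
  ext_cf fun n x => by
    rw [cf_partialY, cf_ofY, cf_ofY, PowerSeries.coeff_derivative, mul_comm]

theorem partialX_coordX : partialX coordX = 1 :=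
  ext_cf fun n x => by
    rw [cf_partialX, funext fun x => cf_coordX n x, ← map_one (algebraMap ℂ FormalFun),
      cf_algebraMap]
    split_ifs <;> simp

theorem partialY_coordX : partialY coordX = 0 :=
  ext_cf fun n x => by
    rw [cf_partialY, cf_coordX, cf_zero_right]
    simp

theorem partialX_partialY (f : FormalFun) : partialX (partialY f) = partialY (partialX f) :=
  ext_cf fun n x => by
    rw [cf_partialX, cf_partialY, cf_partialX, funext fun x => cf_partialY n f x,
      deriv_const_mul_field]

theorem partialX_ofY_mul (g : PowerSeries ℂ) (f : FormalFun) :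
    partialX (ofY g * f) = ofY g * partialX f := by
  rw [Derivation.leibniz, partialX_ofY, smul_zero, add_zero, smul_eq_mul]

/-! ### The vector field `v₀` and the rotations that preserve it -/

namespace NormalForm

variable (M : NormalForm)

theorem v₀_apply (f : FormalFun) : M.v₀ f = ofY (PowerSeries.X ^ (M.k + 1) * M.unitSeries)
    * partialY f + ofY (PowerSeries.C M.τ * M.reflected * M.unitSeries) * partialX f := rfl

theorem τ_ne_zero : M.τ ≠ 0 := fun h => by
  have := M.im_pos
  rw [h] at this
  exact lt_irrefl _ this

theorem one_add_mul_unitSeries :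
    (1 + PowerSeries.C M.ν * PowerSeries.X ^ M.k) * M.unitSeries = 1 := by
  refine PowerSeries.mul_inv_cancel _ ?_
  have := M.k_pos
  simp [zero_pow this.ne']

theorem v₀_ofY (g : PowerSeries ℂ) : M.v₀ (ofY g)
    = ofY (PowerSeries.X ^ (M.k + 1) * M.unitSeries * PowerSeries.derivative ℂ g) := by
  rw [v₀_apply, partialX_ofY, mul_zero, add_zero, partialY_ofY, map_mul ofY (_ * _)]

theorem v₀_coordX : M.v₀ coordX = ofY (PowerSeries.C M.τ * M.reflected * M.unitSeries) := by
  rw [v₀_apply, partialX_coordX, partialY_coordX, mul_zero, zero_add, mul_one]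

theorem shift_v₀ (c : ℂ) (f : FormalFun) : shift c (M.v₀ f) = M.v₀ (shift c f) := by
  rw [v₀_apply, v₀_apply, map_add, map_mul (shift c), map_mul (shift c), shift_ofY,
    shift_ofY, shift_partialX, shift_partialY]

theorem partialX_v₀ (f : FormalFun) : partialX (M.v₀ f) = M.v₀ (partialX f) := by
  rw [v₀_apply, v₀_apply, map_add, partialX_ofY_mul, partialX_ofY_mul, partialX_partialY]

/-- The rotation `y ↦ l y` preserves `v₀`. -/
def IsSymmetry (l : ℂˣ) : Prop :=
  (l : ℂ) ^ M.k = 1 ∧ ∀ j, M.P.coeff j ≠ 0 → (l : ℂ) ^ j = 1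

theorem coeff_reflected (n : ℕ) :
    PowerSeries.coeff n M.reflected = if n ≤ M.k then M.P.coeff (M.k - n) else 0 := by
  rw [reflected, Polynomial.coeff_coe, Polynomial.coeff_reflect]
  split_ifs with h
  · rw [Polynomial.revAt_le h]
  · rw [Polynomial.revAt_eq_self_of_lt (not_le.1 h)]
    refine Polynomial.coeff_eq_zero_of_degree_lt (M.degree_lt.trans ?_)
    exact_mod_cast not_le.1 h

variable {M}

theorem rescale_unitSeries {l : ℂ} (hl : l ^ M.k = 1) :
    PowerSeries.rescale l M.unitSeries = M.unitSeries := by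
  have h := congrArg (PowerSeries.rescale l) M.one_add_mul_unitSeries
  rw [map_mul, map_add, map_mul, map_pow, PowerSeries.rescale_X, mul_pow, ← map_pow, hl,
    map_one PowerSeries.C, one_mul, map_one, rescale_C] at h
  have h2 := M.one_add_mul_unitSeries
  calc _ = (1 + PowerSeries.C M.ν * PowerSeries.X ^ M.k) * M.unitSeries
          * PowerSeries.rescale l M.unitSeries := by rw [h2, one_mul]
    _ = M.unitSeries * ((1 + PowerSeries.C M.ν * PowerSeries.X ^ M.k)
          * PowerSeries.rescale l M.unitSeries) := by ring
    _ = _ := by rw [h, mul_one]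

/-- Reflection exchanges the exponents `j` and `k - j`, and `l ^ j`, `l ^ (k - j)` are mutually
inverse when `l ^ k = 1`. -/
theorem isSymmetry_iff {l : ℂˣ} : M.IsSymmetry l ↔
    (l : ℂ) ^ M.k = 1 ∧ PowerSeries.rescale (l : ℂ) M.reflected = M.reflected := by
  refine and_congr_right fun hl => ⟨fun h => ?_, fun h j hj => ?_⟩
  · ext n
    rw [PowerSeries.coeff_rescale, coeff_reflected]
    split_ifs with hn
    · by_cases hP : M.P.coeff (M.k - n) = 0
      · rw [hP, mul_zero]
      · have h1 := h _ hP
        have h2 : (l : ℂ) ^ n * (l : ℂ) ^ (M.k - n) = 1 := by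
          rw [← pow_add, Nat.add_sub_cancel' hn, hl]
        rw [h1, mul_one] at h2
        rw [h2, one_mul]
    · rw [mul_zero]
  · have hjk : j ≤ M.k := by
      by_contra hlt
      refine hj (Polynomial.coeff_eq_zero_of_degree_lt (M.degree_lt.trans ?_))
      exact_mod_cast not_le.1 hlt
    have h1 := congrArg (PowerSeries.coeff (M.k - j)) h
    rw [PowerSeries.coeff_rescale, coeff_reflected, if_pos (Nat.sub_le _ _),
      Nat.sub_sub_self hjk] at h1
    have h2 : (l : ℂ) ^ (M.k - j) = 1 := mul_right_cancel₀ hj (by rw [h1, one_mul])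
    have h3 : (l : ℂ) ^ j * (l : ℂ) ^ (M.k - j) = 1 := by
      rw [← pow_add, Nat.add_sub_cancel' hjk, hl]
    rwa [h2, mul_one] at h3

/-- The rotation multiplies `∂_y` by `l⁻¹` and `y ^ (k + 1)` by `l ^ (k + 1) = l`; these factors
cancel, and the other ingredients of `v₀` are invariant. -/
theorem IsSymmetry.rot_v₀ {l : ℂˣ} (hl : M.IsSymmetry l) (f : FormalFun) :
    rot l (M.v₀ f) = M.v₀ (rot l f) := by
  have hR := (isSymmetry_iff.1 hl).2
  have h1 : PowerSeries.rescale (l : ℂ) (PowerSeries.X ^ (M.k + 1) * M.unitSeries)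
      = PowerSeries.C (l : ℂ) * (PowerSeries.X ^ (M.k + 1) * M.unitSeries) := by
    rw [map_mul, map_pow, PowerSeries.rescale_X, mul_pow, ← map_pow, pow_succ (l : ℂ), hl.1,
      one_mul, rescale_unitSeries hl.1, mul_assoc]
  have h2 : PowerSeries.rescale (l : ℂ) (PowerSeries.C M.τ * M.reflected * M.unitSeries)
      = PowerSeries.C M.τ * M.reflected * M.unitSeries := by
    rw [map_mul, map_mul, rescale_unitSeries hl.1, hR, rescale_C]
  rw [v₀_apply, v₀_apply, map_add, map_mul (rot l), map_mul (rot l), rot_ofY,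
    rot_ofY, rot_partialX, ← rot_partialY, h1, h2, map_mul ofY, ofY_C, Algebra.smul_def]
  ring

/-! ### The flow of the commuting vector fields `v₀` and `∂_x` -/

theorem shift_lieSeries (s c : ℂ) (f : FormalFun) :
    shift c (lieSeries (s • M.v₀) f) = lieSeries (s • M.v₀) (shift c f) :=
  M.v₀_raisesOrder.map_lieSeries_smul (filtered_algHom (shift c).toAlgHom) (M.shift_v₀ c) s f

theorem partialX_lieSeries (s : ℂ) (f : FormalFun) :
    partialX (lieSeries (s • M.v₀) f) = lieSeries (s • M.v₀) (partialX f) :=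
  M.v₀_raisesOrder.map_lieSeries_smul filtered_partialX M.partialX_v₀ s f

theorem IsSymmetry.rot_lieSeries {l : ℂˣ} (hl : M.IsSymmetry l) (s : ℂ) (f : FormalFun) :
    rot l (lieSeries (s • M.v₀) f) = lieSeries (s • M.v₀) (rot l f) :=
  M.v₀_raisesOrder.map_lieSeries_smul (filtered_algHom (rot l).toAlgHom) hl.rot_v₀ s f

variable (M)

/-- The action of `ℂ × ℂ` by pull-back under `exp (s v₀ + c ∂_x)`. -/
def flow : Multiplicative (ℂ × ℂ) →* (FormalFun ≃ₐ[ℂ] FormalFun) where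
  toFun p := (M.v₀_raisesOrder.smul p.toAdd.1).exp * shift p.toAdd.2
  map_one' := by
    ext1 f
    change lieSeries ((0 : ℂ) • M.v₀) (shift 0 f) = f
    rw [shift_zero, zero_smul, RaisesOrder.lieSeries_zero]
    rfl
  map_mul' p q := by
    ext1 f
    change lieSeries ((p.toAdd.1 + q.toAdd.1) • M.v₀) (shift (p.toAdd.2 + q.toAdd.2) f)
      = lieSeries (p.toAdd.1 • M.v₀) (shift p.toAdd.2
          (lieSeries (q.toAdd.1 • M.v₀) (shift q.toAdd.2 f)))
    rw [shift_lieSeries, M.v₀_raisesOrder.lieSeries_add_smul, shift_add]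
    rfl

theorem flow_apply (s c : ℂ) (f : FormalFun) :
    M.flow (Multiplicative.ofAdd (s, c)) f = lieSeries (s • M.v₀) (shift c f) := rfl

theorem deckOne_eq_flow : deckOne = M.flow (Multiplicative.ofAdd (0, 1)) := by
  ext1 f
  rw [flow_apply, zero_smul, RaisesOrder.lieSeries_zero]
  rfl

theorem deckTau_eq_flow : M.deckTau = M.flow (Multiplicative.ofAdd (1, M.τ)) := by
  ext1 f
  rw [flow_apply, one_smul]
  rfl

/-- Both generators lie in the image of `flow`, so the deck group is the image of the lattice
spanned by `(0, 1)` and `(1, τ)` in `ℂ × ℂ`. -/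
theorem mem_deckGroup_iff {σ : FormalFun ≃ₐ[ℂ] FormalFun} : σ ∈ M.deckGroup ↔
    ∃ a b : ℤ, σ = M.flow (Multiplicative.ofAdd ((b : ℂ), (a : ℂ) + b * M.τ)) := by
  have h : M.deckGroup = (Subgroup.closure
      {Multiplicative.ofAdd ((0 : ℂ), (1 : ℂ)), Multiplicative.ofAdd ((1 : ℂ), M.τ)}).map
        M.flow := by
    rw [MonoidHom.map_closure, Set.image_pair, ← deckOne_eq_flow, ← deckTau_eq_flow, deckGroup]
  rw [h, Subgroup.mem_map]
  constructor
  · rintro ⟨p, hp, rfl⟩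
    obtain ⟨a, b, rfl⟩ := Subgroup.mem_closure_pair.1 hp
    refine ⟨a, b, congrArg _ ?_⟩
    rw [← ofAdd_zsmul, ← ofAdd_zsmul, ← ofAdd_add]
    simp
  · rintro ⟨a, b, rfl⟩
    refine ⟨_, Subgroup.mem_closure_pair.2 ⟨a, b, rfl⟩, congrArg _ ?_⟩
    rw [← ofAdd_zsmul, ← ofAdd_zsmul, ← ofAdd_add]
    simp

theorem cf_zero_flow (s c p : ℂ) (f : FormalFun) :
    cf 0 (M.flow (Multiplicative.ofAdd (s, c)) f) p = cf 0 f (p + c) := by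
  rw [flow_apply, M.v₀_raisesOrder.cf_lieSeries_smul Nat.zero_lt_one]
  simp [cf_shift]

theorem v₀_iterate_coordY_dvd (m : ℕ) :
    PowerSeries.X ^ (M.k + 1 + m) ∣ (M.v₀)^[m + 1] coordY := by
  rw [Function.iterate_succ_apply]
  refine M.v₀_raisesOrder.iterate_dvd m _ _ ?_
  rw [coordY_eq_ofY, v₀_ofY, mul_assoc, map_mul, map_pow, ofY_X]
  exact dvd_mul_right _ _

/-- Two or more applications of `v₀` to `y` have order at least `k + 2`, so only the linear term in
`s` is visible. This is what lets `s` be read off, or adjusted, at order `k + 1`. -/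
theorem flow_coordY_dvd (s c : ℂ) : PowerSeries.X ^ (M.k + 2) ∣
    M.flow (Multiplicative.ofAdd (s, c)) coordY - (coordY + s • coordY ^ (M.k + 1)) := by
  rw [X_pow_dvd_iff_cf]
  intro n hn x
  have h2 : cf n (M.v₀ coordY) x = cf n (coordY ^ (M.k + 1)) x := by
    have hu : PowerSeries.X ∣ M.unitSeries - 1 := by
      rw [PowerSeries.X_dvd_iff]
      have := congrArg PowerSeries.constantCoeff M.one_add_mul_unitSeries
      simp only [map_mul, map_add, map_one, map_pow, PowerSeries.constantCoeff_X,
        zero_pow M.k_pos.ne', mul_zero, add_zero, one_mul] at this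
      rw [map_sub, this, map_one, sub_self]
    obtain ⟨u, hu⟩ := hu
    rw [coordY_eq_ofY, v₀_ofY, PowerSeries.derivative_X, mul_one, ← map_pow, cf_ofY, cf_ofY,
      ← sub_eq_zero, ← map_sub, ← mul_sub_one, hu, ← mul_assoc, ← pow_succ,
      PowerSeries.coeff_X_pow_mul', if_neg (by omega)]
  rw [cf_sub, flow_apply, shift_coordY,
    M.v₀_raisesOrder.cf_lieSeries_smul (N := M.k + 3) (by omega),
    Finset.sum_range_succ', Finset.sum_range_succ']
  have h3 : ∀ m ∈ Finset.range (M.k + 1), s ^ (m + 1 + 1) * (((m + 1 + 1).factorial : ℂ)⁻¹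
      * cf n ((M.v₀)^[m + 1 + 1] coordY) x) = 0 := by
    intro m _
    rw [X_pow_dvd_iff_cf.1 (M.v₀_iterate_coordY_dvd (m + 1)) n (by omega) x, mul_zero, mul_zero]
  rw [Finset.sum_eq_zero h3]
  simp only [zero_add, pow_one, Nat.factorial_one, Nat.cast_one, inv_one, one_mul,
    Function.iterate_one, pow_zero, Nat.factorial_zero, Function.iterate_zero, id_eq]
  rw [cf_add, cf_smul, h2]
  ring

end NormalForm

/-! ### Automorphisms commuting with the deck transformations -/

/-- An entire function with periods `1` and `τ` is constant. -/
theorem exists_eq_const_of_doubly_periodic {τ : ℂ} (hτ : 0 < τ.im) {c : ℂ → ℂ}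
    (hd : Differentiable ℂ c) (h1 : Function.Periodic c 1) (h2 : Function.Periodic c τ) :
    ∃ a, ∀ x, c x = a := by
  have hK : IsCompact ((fun p : ℝ × ℝ => (p.1 : ℂ) + p.2 * τ) ''
      (Set.Icc 0 1 ×ˢ Set.Icc 0 1)) :=
    (isCompact_Icc.prod isCompact_Icc).image (by fun_prop)
  have hb : Bornology.IsBounded (Set.range c) := by
    refine (hK.image hd.continuous).isBounded.subset ?_
    rintro _ ⟨x, rfl⟩
    set t : ℝ := x.im / τ.im with ht
    set s : ℝ := x.re - t * τ.re with hs
    have hx : x = s + t * τ := by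
      apply Complex.ext
      · simp [hs]
      · simp [ht, hτ.ne']
    refine ⟨_, ⟨(Int.fract s, Int.fract t), ⟨⟨Int.fract_nonneg _, (Int.fract_lt_one _).le⟩,
      ⟨Int.fract_nonneg _, (Int.fract_lt_one _).le⟩⟩, rfl⟩, ?_⟩
    have h3 : ((Int.fract s : ℝ) : ℂ) + (Int.fract t : ℝ) * τ
        = x - ⌊s⌋ • (1 : ℂ) - ⌊t⌋ • τ := by
      rw [Int.fract, Int.fract, hx]
      push_cast
      simp only [zsmul_eq_mul]
      ring
    change c (((Int.fract s : ℝ) : ℂ) + (Int.fract t : ℝ) * τ) = c x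
    rw [h3, h2.sub_zsmul_eq, h1.sub_zsmul_eq]
  obtain ⟨a, ha⟩ := hd.exists_eq_const_of_bounded hb
  exact ⟨a, fun x => by rw [ha]; rfl⟩

theorem exists_eq_ofY {f : FormalFun} (h : partialX f = 0) : ∃ g, f = ofY g :=
  ⟨PowerSeries.mk fun n => cf n f 0, ext_cf fun n x => by
    rw [cf_ofY, PowerSeries.coeff_mk]
    refine is_const_of_deriv_eq_zero (differentiable_cf n f) (fun y => ?_) x 0
    rw [← cf_partialX, h, cf_zero_right]⟩

theorem X_pow_dvd_of_ofY {n : ℕ} {g : PowerSeries ℂ} (h : PowerSeries.X ^ n ∣ ofY g) :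
    PowerSeries.X ^ n ∣ g := by
  rw [PowerSeries.X_pow_dvd_iff]
  intro m hm
  rw [← cf_ofY m 0]
  exact X_pow_dvd_iff_cf.1 h m hm 0

theorem RaisesOrder.X_pow_dvd_lieSeries_sub_self {E : Derivation ℂ FormalFun FormalFun}
    (hE : RaisesOrder E) {n : ℕ} {f : FormalFun} (h : PowerSeries.X ^ n ∣ f) :
    PowerSeries.X ^ (n + 1) ∣ lieSeries E f - f := by
  have h1 := hE.X_pow_dvd_lieSeries_sub (n + 1) f
  rw [Finset.sum_range_succ'] at h1
  have h2 : (PowerSeries.X : FormalFun) ^ (n + 1) ∣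
      ∑ m ∈ Finset.range n, (((m + 1).factorial : ℂ)⁻¹) • E^[m + 1] f := by
    refine Finset.dvd_sum fun m _ => ?_
    have h3 := hE.lieTerm_dvd (m + 1) n f h
    exact (pow_dvd_pow _ (by omega)).trans h3
  have h4 := dvd_add h1 h2
  convert h4 using 1
  simp only [Nat.factorial_zero, Nat.cast_one, inv_one, one_smul, Function.iterate_zero, id_eq]
  abel

/-- A derivation of a function of `σ^* y` is divisible by `y ^ n` when that of `σ^* y` is. -/
theorem X_pow_dvd_partialX_map_ofY (σ : FormalFun →ₐ[ℂ] FormalFun) {n : ℕ}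
    (h : PowerSeries.X ^ n ∣ partialX (σ coordY)) (g : PowerSeries ℂ) :
    PowerSeries.X ^ n ∣ partialX (σ (ofY g)) := by
  suffices H : ∀ m ≤ n, ∀ g, (PowerSeries.X : FormalFun) ^ m ∣ partialX (σ (ofY g)) from
    H n le_rfl g
  intro m
  induction m with
  | zero => intro _ g; simp
  | succ m ih =>
    intro hm g
    have h1 := congrArg (fun f => partialX (σ (ofY f))) (PowerSeries.eq_X_mul_shift_add_const g)
    simp only [map_add, map_mul, ofY_C, AlgHom.commutes, Derivation.map_algebraMap, add_zero,
      ← coordY_eq_ofY, Derivation.leibniz, smul_eq_mul] at h1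
    rw [h1]
    refine dvd_add ?_ (Dvd.dvd.mul_left ((pow_dvd_pow _ hm).trans h) _)
    rw [pow_succ']
    exact mul_dvd_mul (X_dvd_map_coordY σ) (ih (by omega) _)

namespace NormalForm

variable (M : NormalForm)

theorem mem_lattice_iff {x : ℂ} : x ∈ M.lattice ↔ ∃ a b : ℤ, x = a + b * M.τ := by
  rw [lattice, AddSubgroup.mem_closure_pair]
  simp only [zsmul_eq_mul, mul_one, eq_comm]

theorem flow_coordX (s c : ℂ) : ∃ g, M.flow (Multiplicative.ofAdd (s, c)) coordX
    = coordX + algebraMap ℂ FormalFun c + ofY g := by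
  obtain ⟨g, hg⟩ := exists_eq_ofY (f := lieSeries (s • M.v₀) coordX - coordX) (by
    rw [map_sub, partialX_lieSeries, partialX_coordX, ← map_one (algebraMap ℂ FormalFun),
      RaisesOrder.lieSeries_algebraMap, sub_self])
  refine ⟨g, ?_⟩
  rw [flow_apply, shift_coordX, RaisesOrder.lieSeries_add, RaisesOrder.lieSeries_algebraMap, ← hg]
  ring

theorem flow_coordY (s c : ℂ) : ∃ g, M.flow (Multiplicative.ofAdd (s, c)) coordY
    = coordY + ofY (PowerSeries.X ^ 2 * g) := by
  obtain ⟨g, hg⟩ := exists_eq_ofY (f := lieSeries (s • M.v₀) coordY - coordY) (by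
    rw [map_sub, partialX_lieSeries, coordY_eq_ofY, partialX_ofY,
      ← map_zero (algebraMap ℂ FormalFun), RaisesOrder.lieSeries_algebraMap, sub_self, map_zero])
  obtain ⟨g', rfl⟩ := X_pow_dvd_of_ofY (n := 2) (g := g) (by
    rw [← hg]
    refine (M.v₀_raisesOrder.smul s).X_pow_dvd_lieSeries_sub_self ?_
    rw [pow_one]; exact dvd_rfl)
  refine ⟨g', ?_⟩
  rw [flow_apply, shift_coordY, ← hg]
  ring

theorem shift_eq_flow (c : ℂ) : shift c = M.flow (Multiplicative.ofAdd (0, c)) := by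
  ext1 f
  rw [flow_apply, zero_smul, RaisesOrder.lieSeries_zero]

/-- The step of the induction on the order in `y` which shows that invariants of the deck
transformations do not depend on `x`. -/
theorem X_pow_succ_dvd_partialX {h : FormalFun} {n : ℕ} (h1 : shift 1 h = h)
    (hn : PowerSeries.X ^ n ∣ partialX h)
    (hτ : PowerSeries.X ^ (n + 1) ∣ M.deckTau (partialX h) - partialX h) :
    PowerSeries.X ^ (n + 1) ∣ partialX h := by
  -- On a function of order `n`, `exp v₀` acts trivially modulo order `n + 1`, so φ_τ acts on the
  -- leading coefficient as translation by τ alone.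
  have hs : ∀ x, cf n (partialX h) (x + M.τ) = cf n (partialX h) x := by
    intro x
    have h2 := M.v₀_raisesOrder.X_pow_dvd_lieSeries_sub_self
      (f := shift M.τ (partialX h)) (X_pow_dvd_map (shift M.τ).toAlgHom hn)
    have h3 := X_pow_dvd_iff_cf.1 h2 n (Nat.lt_succ_self n) x
    have h4 := X_pow_dvd_iff_cf.1 hτ n (Nat.lt_succ_self n) x
    rw [cf_sub, sub_eq_zero, cf_shift] at h3
    rw [cf_sub, sub_eq_zero] at h4
    rw [← h3, ← h4]
    rfl
  have hper : Function.Periodic (cf n h) 1 := fun x => by rw [← cf_shift, h1]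
  have h1' : Function.Periodic (cf n (partialX h)) 1 := fun x => by
    rw [← cf_shift, shift_partialX, h1]
  obtain ⟨a, ha⟩ := exists_eq_const_of_doubly_periodic M.im_pos
    (differentiable_cf n (partialX h)) h1' hs
  -- The coefficient of `h` is affine in `x` with slope `a`, and 1-periodicity excludes a nonzero
  -- slope.
  have ha0 : a = 0 := by
    have hd : ∀ x, HasDerivAt (fun x => cf n h x - a * x) 0 x := by
      intro x
      have h5 := (differentiable_cf n h x).hasDerivAt.sub ((hasDerivAt_id x).const_mul a)
      rw [← cf_partialX, ha, mul_one, sub_self] at h5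
      exact h5
    have h6 := is_const_of_deriv_eq_zero (fun x => (hd x).differentiableAt)
      (fun x => (hd x).deriv) 1 0
    have h7 := hper 0
    rw [zero_add] at h7
    rw [h7] at h6
    simpa using h6
  rw [X_pow_dvd_iff_cf]
  intro m hm x
  rcases Nat.lt_succ_iff_lt_or_eq.1 hm with hm | rfl
  · exact X_pow_dvd_iff_cf.1 hn m hm x
  · rw [ha, ha0]

theorem partialX_deckTau (f : FormalFun) : partialX (M.deckTau f) = M.deckTau (partialX f) := by
  rw [deckTau_eq_flow, flow_apply, flow_apply, partialX_lieSeries, shift_partialX]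

variable {M}
variable {σ : FormalFun ≃ₐ[ℂ] FormalFun}

/-- Since φ_τ changes `y` by `y ^ 2 g(y)`, the defect of τ-invariance of `∂_x (σ^* y)` is the
`∂_x`-derivative of `(σ^* y) ^ 2 σ^* g`. Every term of that derivative keeps a spare factor `σ^* y`,
so its order exceeds the one already known for `∂_x (σ^* y)`. -/
theorem exists_map_coordY (h1 : Commute σ deckOne) (hτ : Commute σ M.deckTau) :
    ∃ g, σ coordY = ofY g := by
  have hone : ∀ f, deckOne (σ f) = σ (deckOne f) := fun f =>
    (congrArg (fun φ : FormalFun ≃ₐ[ℂ] FormalFun => φ f) h1.eq).symm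
  have htau : ∀ f, M.deckTau (σ f) = σ (M.deckTau f) := fun f =>
    (congrArg (fun φ : FormalFun ≃ₐ[ℂ] FormalFun => φ f) hτ.eq).symm
  refine exists_eq_ofY ?_
  refine eq_of_forall_X_pow_dvd_sub fun n => ?_
  rw [sub_zero]
  induction n with
  | zero => simp
  | succ n ih =>
    refine M.X_pow_succ_dvd_partialX ?_ ih ?_
    · exact (hone coordY).trans (congrArg σ (shift_coordY 1))
    · obtain ⟨g, hg⟩ := M.flow_coordY 1 M.τ
      rw [← deckTau_eq_flow] at hg
      have h2 : M.deckTau (partialX (σ coordY)) - partialX (σ coordY)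
          = partialX (σ coordY ^ 2 * σ (ofY g)) := by
        rw [← partialX_deckTau, htau, hg, map_add, map_add, add_sub_cancel_left, map_mul, map_pow,
          ← coordY_eq_ofY, map_mul, map_pow]
      have h3 := X_pow_dvd_partialX_map_ofY σ.toAlgHom ih g
      have h4 := X_dvd_map_coordY σ.toAlgHom
      change PowerSeries.X ∣ σ coordY at h4
      change _ ∣ partialX (σ (ofY g)) at h3
      rw [h2, Derivation.leibniz, sq, Derivation.leibniz, pow_succ']
      simp only [smul_eq_mul]
      refine dvd_add ?_ (Dvd.dvd.mul_left ?_ _)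
      · rw [mul_assoc]
        exact mul_dvd_mul h4 (Dvd.dvd.mul_left h3 _)
      · exact dvd_add (mul_dvd_mul h4 ih) (mul_dvd_mul h4 ih)

/-- The same induction, applied to the 1-periodic function `σ^* x - x`. Here the defect is `∂_x` of
a function of `σ^* y`, which vanishes because `σ^* y` is already known to depend on `y` only. -/
theorem exists_map_coordX (h1 : Commute σ deckOne) (hτ : Commute σ M.deckTau) :
    ∃ g, σ coordX = coordX + ofY g := by
  have hone : ∀ f, deckOne (σ f) = σ (deckOne f) := fun f =>
    (congrArg (fun φ : FormalFun ≃ₐ[ℂ] FormalFun => φ f) h1.eq).symm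
  have htau : ∀ f, M.deckTau (σ f) = σ (M.deckTau f) := fun f =>
    (congrArg (fun φ : FormalFun ≃ₐ[ℂ] FormalFun => φ f) hτ.eq).symm
  obtain ⟨B, hB⟩ := exists_map_coordY h1 hτ
  have hpB : partialX (σ coordY) = 0 := by rw [hB, partialX_ofY]
  suffices H : partialX (σ coordX - coordX) = 0 by
    obtain ⟨g, hg⟩ := exists_eq_ofY H
    exact ⟨g, by rw [← hg]; ring⟩
  refine eq_of_forall_X_pow_dvd_sub fun n => ?_
  rw [sub_zero]
  induction n with
  | zero => simp
  | succ n ih =>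
    refine M.X_pow_succ_dvd_partialX ?_ ih ?_
    · have h3 := hone coordX
      rw [deckOne, shift_coordX, map_add, AlgEquiv.commutes] at h3
      rw [map_sub, shift_coordX, h3]
      ring
    · obtain ⟨g, hg⟩ := M.flow_coordX 1 M.τ
      rw [← deckTau_eq_flow] at hg
      have h2 : M.deckTau (partialX (σ coordX - coordX)) - partialX (σ coordX - coordX)
          = partialX (σ (ofY g)) := by
        rw [← partialX_deckTau, map_sub, htau, hg, map_add, map_add, AlgEquiv.commutes]
        simp only [map_add, map_sub, partialX_ofY, Derivation.map_algebraMap]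
        ring
      rw [h2]
      exact X_pow_dvd_partialX_map_ofY σ.toAlgHom
        (by change _ ∣ partialX (σ coordY); rw [hpB]; exact dvd_zero _) g

theorem commute_shift (h1 : Commute σ deckOne) (hτ : Commute σ M.deckTau) (c : ℂ) :
    Commute σ (shift c) := by
  obtain ⟨B, hB⟩ := exists_map_coordY h1 hτ
  obtain ⟨A, hA⟩ := exists_map_coordX h1 hτ
  refine algEquiv_ext ?_ ?_
  · rw [AlgEquiv.mul_apply, AlgEquiv.mul_apply, shift_coordX, map_add, AlgEquiv.commutes, hA,
      map_add, shift_coordX, shift_ofY]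
    ring
  · rw [AlgEquiv.mul_apply, AlgEquiv.mul_apply, shift_coordY, hB, shift_ofY]

/-- Since σ commutes with all translations, the translation by τ can be stripped from φ_τ. This
leaves commutation with `exp v₀` and its powers, which is enough to recover the generator. -/
theorem map_v₀ (h1 : Commute σ deckOne) (hτ : Commute σ M.deckTau) (f : FormalFun) :
    σ (M.v₀ f) = M.v₀ (σ f) := by
  have h2 : Commute σ (M.flow (Multiplicative.ofAdd (1, 0))) := by
    have : M.flow (Multiplicative.ofAdd (1, 0)) = M.deckTau * shift (-M.τ) := by
      rw [deckTau_eq_flow, shift_eq_flow, ← map_mul, ← ofAdd_add]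
      simp
    rw [this]
    exact hτ.mul_right (commute_shift h1 hτ _)
  refine M.v₀_raisesOrder.map_apply_of_map_lieSeries (filtered_algHom σ.toAlgHom)
    (fun n f => ?_) f
  have h3 := h2.pow_right n
  rw [← map_pow, ← ofAdd_nsmul] at h3
  have h4 := congrArg (fun φ : FormalFun ≃ₐ[ℂ] FormalFun => φ f) h3.eq
  have h5 : n • ((1 : ℂ), (0 : ℂ)) = ((n : ℂ), 0) := by simp
  rw [h5] at h4
  simp only [AlgEquiv.mul_apply, flow_apply, shift_zero] at h4
  exact h4

/-! ### Lifts commute with the deck transformations -/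

/-- The point `p'` over `p` is a priori known only modulo the lattice. It equals `σ^* x` at `(p,
0)`, so `p' - p - c₀` is continuous in `p` with values in a countable, hence totally disconnected,
set. -/
theorem exists_translation (hσ : σ ∈ M.lifts) :
    ∃ c, ∀ p f, cf 0 (σ f) p = cf 0 f (p + c) := by
  obtain ⟨-, c, hc⟩ := hσ
  obtain ⟨c₀, rfl⟩ := QuotientAddGroup.mk_surjective c
  have h1 : ∀ p, ∃ p', p' - p - c₀ ∈ M.lattice ∧ ∀ f, cf 0 (σ f) p = cf 0 f p' := by
    intro p
    obtain ⟨p', hp', h⟩ := hc p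
    refine ⟨p', ?_, h⟩
    rw [← QuotientAddGroup.mk_add, eq_comm, QuotientAddGroup.eq] at hp'
    convert hp' using 1
    ring
  have h2 : ∀ p, cf 0 (σ coordX) p - p - c₀ ∈ M.lattice ∧
      ∀ f, cf 0 (σ f) p = cf 0 f (cf 0 (σ coordX) p) := by
    intro p
    obtain ⟨p', hp', h⟩ := h1 p
    have h3 : cf 0 (σ coordX) p = p' := by rw [h, cf_coordX, if_pos rfl]
    rw [h3]
    exact ⟨hp', h⟩
  have hcount : (M.lattice : Set ℂ).Countable := by
    refine (Set.countable_range fun q : ℤ × ℤ => (q.1 : ℂ) + q.2 * M.τ).mono ?_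
    intro x hx
    obtain ⟨a, b, rfl⟩ := M.mem_lattice_iff.1 hx
    exact ⟨(a, b), rfl⟩
  have hcont : Continuous fun p => cf 0 (σ coordX) p - p - c₀ := by
    have := (differentiable_cf 0 (σ coordX)).continuous
    fun_prop
  have hsub := hcount.isTotallyDisconnected _ (Set.image_subset_iff.2 fun p _ => (h2 p).1)
    (isPreconnected_univ.image _ hcont.continuousOn)
  refine ⟨cf 0 (σ coordX) 0, fun p f => ?_⟩
  have h4 := hsub (Set.mem_image_of_mem _ (Set.mem_univ p))
    (Set.mem_image_of_mem _ (Set.mem_univ (0 : ℂ)))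
  have h5 : cf 0 (σ coordX) p = p + cf 0 (σ coordX) 0 := by
    linear_combination h4
  rw [(h2 p).2, h5]

theorem int_add_int_mul_τ_inj {a b a' b' : ℤ}
    (h : (a : ℂ) + b * M.τ = a' + b' * M.τ) : a = a' ∧ b = b' := by
  have him := congrArg Complex.im h
  simp only [Complex.add_im, Complex.intCast_im, Complex.mul_im, Complex.intCast_re, zero_mul,
    add_zero, zero_add] at him
  have hb : (b : ℝ) = b' := mul_right_cancel₀ M.im_pos.ne' him
  have hb' : b = b' := by exact_mod_cast hb
  subst hb'
  exact ⟨by exact_mod_cast add_right_cancel h, rfl⟩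

/-- A lift normalizes the group of deck transformations and covers a translation, hence commutes
with the deck transformations. -/
theorem commute_flow_of_mem_lifts (hσ : σ ∈ M.lifts) (a b : ℤ) :
    Commute σ (M.flow (Multiplicative.ofAdd ((b : ℂ), (a : ℂ) + b * M.τ))) := by
  obtain ⟨c, hc⟩ := exists_translation hσ
  have h1 := (Subgroup.mem_normalizer_iff.1 hσ.1 _).1 (M.mem_deckGroup_iff.2 ⟨a, b, rfl⟩)
  obtain ⟨a', b', h⟩ := M.mem_deckGroup_iff.1 h1
  rw [mul_inv_eq_iff_eq_mul] at h
  -- Evaluating `x` at the origin compares the two translations of `{y = 0}`, which determine the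
  -- deck transformation.
  have h2 := congrArg (fun φ : FormalFun ≃ₐ[ℂ] FormalFun => cf 0 (φ coordX) 0) h
  simp only [AlgEquiv.mul_apply, hc, cf_zero_flow, cf_coordX, if_true, zero_add] at h2
  rw [add_comm c] at h2
  obtain ⟨rfl, rfl⟩ := int_add_int_mul_τ_inj (add_right_cancel h2)
  exact h

theorem commute_deckOne_of_mem_lifts (hσ : σ ∈ M.lifts) : Commute σ deckOne := by
  have := commute_flow_of_mem_lifts hσ 1 0
  rw [M.deckOne_eq_flow]
  simpa using this

theorem commute_deckTau_of_mem_lifts (hσ : σ ∈ M.lifts) : Commute σ M.deckTau := by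
  have := commute_flow_of_mem_lifts hσ 0 1
  rw [M.deckTau_eq_flow]
  simpa using this

end NormalForm

/-! ### Classification of the automorphisms -/

/-- No continuity of σ is assumed: factors of `y` are peeled off one at a time, and the difference
ends up divisible by every power of `y`. -/
theorem map_ofY_of_map_coordY {σ : FormalFun →ₐ[ℂ] FormalFun} {l : ℂ}
    (h : σ coordY = l • coordY) (g : PowerSeries ℂ) :
    σ (ofY g) = ofY (PowerSeries.rescale l g) := by
  refine eq_of_forall_X_pow_dvd_sub fun n => ?_
  induction n generalizing g with
  | zero => simp
  | succ n ih =>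
    obtain ⟨g', a, hg⟩ : ∃ g' a, g = PowerSeries.X * g' + PowerSeries.C a :=
      ⟨_, _, PowerSeries.eq_X_mul_shift_add_const g⟩
    have h1 : σ (ofY g) - ofY (PowerSeries.rescale l g)
        = PowerSeries.X * (l • (σ (ofY g') - ofY (PowerSeries.rescale l g'))) := by
      rw [hg]
      simp only [map_add, map_mul, ofY_C, AlgHom.commutes, rescale_C, PowerSeries.rescale_X, ofY_X]
      rw [show (PowerSeries.X : FormalFun) = coordY from rfl, h, Algebra.smul_def,
        Algebra.smul_def]
      ring
    rw [h1, pow_succ']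
    obtain ⟨w, hw⟩ := ih g'
    exact mul_dvd_mul_left _ ⟨l • w, by rw [hw, mul_smul_comm]⟩

/-! ### The equation for `σ^* y` and its resonance at order `k` -/

namespace NormalForm

variable {M : NormalForm} {σ : FormalFun ≃ₐ[ℂ] FormalFun}

theorem map_ofY_unitSeries {l : FormalFun} (h : σ coordY = l) :
    (1 + algebraMap ℂ FormalFun M.ν * l ^ M.k) * σ (ofY M.unitSeries) = 1 := by
  have h1 := congrArg (fun g => σ (ofY g)) M.one_add_mul_unitSeries
  simp only [map_mul, map_add, map_one, map_pow, ofY_C, AlgEquiv.commutes,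
    ← coordY_eq_ofY, h] at h1
  exact h1

variable (M) in
/-- The equation satisfied by `σ^* y = y V` when `σ` commutes with `v₀`. -/
def CommutationEquation (V : PowerSeries ℂ) : Prop :=
  PowerSeries.derivative ℂ (PowerSeries.X * V)
      * (1 + PowerSeries.C M.ν * PowerSeries.X ^ M.k * V ^ M.k)
    = V ^ (M.k + 1) * (1 + PowerSeries.C M.ν * PowerSeries.X ^ M.k)

/-- With `B = y V`, this is `y ^ (k+1) B' / (1 + ν y ^ k) = B ^ (k+1) / (1 + ν B ^ k)`, cleared of
denominators and divided by `y ^ (k + 1)`. -/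
theorem equation_of_commute {V : PowerSeries ℂ} (hv : σ (M.v₀ coordY) = M.v₀ (σ coordY))
    (hV : σ coordY = ofY (PowerSeries.X * V)) : M.CommutationEquation V := by
  have h1 := map_ofY_unitSeries (M := M) hV
  have h2 : σ (M.v₀ coordY) = ofY (PowerSeries.X * V) ^ (M.k + 1) * σ (ofY M.unitSeries) := by
    rw [coordY_eq_ofY, v₀_ofY, PowerSeries.derivative_X, mul_one, map_mul, map_pow, map_mul,
      map_pow, ← coordY_eq_ofY, hV]
  rw [h2, hV, v₀_ofY] at hv
  rw [← ofY_C, ← map_pow, ← map_mul, ← map_one ofY, ← map_add] at h1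
  have h3 : ofY ((PowerSeries.X * V) ^ (M.k + 1)) = ofY (PowerSeries.X ^ (M.k + 1)
      * M.unitSeries * PowerSeries.derivative ℂ (PowerSeries.X * V)
        * (1 + PowerSeries.C M.ν * (PowerSeries.X * V) ^ M.k)) := by
    rw [map_mul ofY (_ * _), ← hv, mul_assoc, mul_comm (σ _), h1, map_one, mul_one, map_pow]
  have h4 := ofY_injective h3
  have h5 := M.one_add_mul_unitSeries
  have hX : (PowerSeries.X : PowerSeries ℂ) ^ (M.k + 1) ≠ 0 := pow_ne_zero _ PowerSeries.X_ne_zero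
  refine mul_left_cancel₀ hX ?_
  calc _ = (PowerSeries.X : PowerSeries ℂ) ^ (M.k + 1)
          * ((1 + PowerSeries.C M.ν * PowerSeries.X ^ M.k) * M.unitSeries)
          * PowerSeries.derivative ℂ (PowerSeries.X * V)
          * (1 + PowerSeries.C M.ν * (PowerSeries.X * V) ^ M.k) := by rw [h5]; ring
    _ = (PowerSeries.X * V) ^ (M.k + 1) * (1 + PowerSeries.C M.ν * PowerSeries.X ^ M.k) := by
        rw [h4]; ring
    _ = _ := by ring

theorem coeff_derivative_X_mul (V : PowerSeries ℂ) (j : ℕ) :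
    PowerSeries.coeff j (PowerSeries.derivative ℂ (PowerSeries.X * V))
      = (j + 1) * PowerSeries.coeff j V := by
  rw [PowerSeries.coeff_derivative, PowerSeries.coeff_succ_X_mul, mul_comm]

theorem pow_constantCoeff_eq_one {V : PowerSeries ℂ} (hV : M.CommutationEquation V)
    (h0 : PowerSeries.coeff 0 V ≠ 0) :
    PowerSeries.coeff 0 V ^ M.k = 1 := by
  have h1 := congrArg PowerSeries.constantCoeff hV
  have h2 := coeff_derivative_X_mul V 0
  rw [PowerSeries.coeff_zero_eq_constantCoeff_apply] at h2 h0 ⊢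
  rw [map_mul, h2] at h1
  simp only [map_add, map_mul, map_one, map_pow, PowerSeries.constantCoeff_X,
    zero_pow M.k_pos.ne', mul_zero, zero_mul, add_zero, mul_one, Nat.cast_zero, zero_add,
    one_mul, PowerSeries.coeff_zero_eq_constantCoeff_apply] at h1
  rw [pow_succ] at h1
  exact (mul_right_cancel₀ h0 (by rw [one_mul]; exact h1)).symm

/-- Linearize at the constant solution `l`. If `V = l + y ^ j W`, the equation modulo `y ^ (j + 1)`
reads `(j + 1) V_j = (k + 1) V_j`, so only `j = k` can carry a nonzero coefficient. -/
theorem coeff_eq_zero_of_equation {V : PowerSeries ℂ} (hV : M.CommutationEquation V) {l : ℂ}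
    (hl : l ^ M.k = 1) {j : ℕ} (hj : 0 < j) (hjk : j ≠ M.k)
    (hd : PowerSeries.X ^ j ∣ V - PowerSeries.C l) : PowerSeries.coeff j V = 0 := by
  obtain ⟨W, hW⟩ := hd
  have hW' : V = PowerSeries.C l + PowerSeries.X ^ j * W := by rw [← hW]; ring
  obtain ⟨i, rfl⟩ : ∃ i, j = i + 1 := ⟨j - 1, by omega⟩
  obtain ⟨k, hk⟩ : ∃ k, M.k = k + 1 := ⟨M.k - 1, by have := M.k_pos; omega⟩
  have hl' : (PowerSeries.C l : PowerSeries ℂ) ^ M.k = 1 := by rw [← map_pow, hl, map_one]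
  obtain ⟨A, hA⟩ := Polynomial.powAddExpansion (PowerSeries.C l) (PowerSeries.X ^ (i + 1) * W) M.k
  obtain ⟨B, hB⟩ := Polynomial.powAddExpansion (PowerSeries.C l) (PowerSeries.X ^ (i + 1) * W)
    (M.k + 1)
  rw [← hW', hl'] at hA
  rw [← hW', pow_succ (PowerSeries.C l), Nat.add_sub_cancel, hl'] at hB
  set D := PowerSeries.derivative ℂ (PowerSeries.X * V) with hD
  set R : PowerSeries ℂ :=
    PowerSeries.C l + ((M.k + 1 : ℕ) : PowerSeries ℂ) * (PowerSeries.X ^ (i + 1) * W) with hR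
  have h1 : (PowerSeries.X : PowerSeries ℂ) ^ (i + 1 + 1) ∣ D - R := by
    -- As `V ^ k` is 1 modulo `y ^ j`, the ν-terms cancel up to order `j + k`, which is at least `j
    -- + 1`; the quadratic remainder of `V ^ (k + 1)` has order `2 j`.
    have h2 : (D - R) * (1 + PowerSeries.C M.ν * PowerSeries.X ^ M.k)
        = PowerSeries.X ^ (i + 1 + 1) * (PowerSeries.X ^ i * B * W ^ 2
            * (1 + PowerSeries.C M.ν * PowerSeries.X ^ M.k)
          - D * PowerSeries.C M.ν * PowerSeries.X ^ k * W * ((M.k : PowerSeries ℂ)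
            * PowerSeries.C l ^ (M.k - 1) + A * (PowerSeries.X ^ (i + 1) * W))) := by
      have hXk : (PowerSeries.X : PowerSeries ℂ) ^ M.k = PowerSeries.X * PowerSeries.X ^ k := by
        rw [hk, pow_succ']
      rw [CommutationEquation, hA, hB] at hV
      rw [hXk] at hV ⊢
      push_cast at hV hR
      rw [hR]
      linear_combination hV
    have h3 : D - R = (D - R) * (1 + PowerSeries.C M.ν * PowerSeries.X ^ M.k) * M.unitSeries := by
      rw [mul_assoc, M.one_add_mul_unitSeries, mul_one]
    rw [h3, h2, mul_assoc]
    exact dvd_mul_right _ _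
  have h4 := PowerSeries.X_pow_dvd_iff.1 h1 (i + 1) (Nat.lt_succ_self _)
  have hc : PowerSeries.coeff (i + 1) V
      = PowerSeries.coeff (i + 1) (PowerSeries.X ^ (i + 1) * W) := by
    rw [hW', map_add, PowerSeries.coeff_C, if_neg (Nat.succ_ne_zero i), zero_add]
  rw [map_sub, hD, coeff_derivative_X_mul, hR, map_add, PowerSeries.coeff_C,
    if_neg (Nat.succ_ne_zero i), zero_add, ← map_natCast PowerSeries.C, PowerSeries.coeff_C_mul,
    ← hc, ← sub_mul] at h4
  refine (mul_eq_zero.1 h4).resolve_left fun h5 => hjk ?_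
  push_cast at h5
  have h6 : ((i + 1 : ℕ) : ℂ) = (M.k : ℕ) := by push_cast; linear_combination h5
  exact_mod_cast h6

theorem eq_C_of_equation {V : PowerSeries ℂ} (hV : M.CommutationEquation V)
    (h0 : PowerSeries.coeff 0 V ≠ 0) (hk : PowerSeries.coeff M.k V = 0) :
    V = PowerSeries.C (PowerSeries.coeff 0 V) := by
  ext j
  rw [PowerSeries.coeff_C]
  induction j using Nat.strong_induction_on with
  | _ j ih =>
    split_ifs with hj
    · rw [hj]
    · by_cases hjk : j = M.k
      · rw [hjk, hk]
      · refine coeff_eq_zero_of_equation hV (pow_constantCoeff_eq_one hV h0)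
          (Nat.pos_of_ne_zero hj) hjk ?_
        rw [PowerSeries.X_pow_dvd_iff]
        intro m hm
        rw [map_sub, ih m hm, PowerSeries.coeff_C, sub_self]

theorem exists_map_coordY_eq_X_mul (h1 : Commute σ deckOne) (hτ : Commute σ M.deckTau) :
    ∃ V, σ coordY = ofY (PowerSeries.X * V) ∧ PowerSeries.coeff 0 V ≠ 0 := by
  obtain ⟨B, hB⟩ := exists_map_coordY h1 hτ
  obtain ⟨V, rfl⟩ : PowerSeries.X ∣ B := by
    have h2 := X_dvd_map_coordY σ.toAlgHom
    change PowerSeries.X ∣ σ coordY at h2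
    rw [hB] at h2
    simpa using X_pow_dvd_of_ofY (n := 1) (by simpa using h2)
  refine ⟨V, hB, fun h0 => ?_⟩
  obtain ⟨W, rfl⟩ : PowerSeries.X ∣ V := by
    rw [PowerSeries.X_dvd_iff]; simpa using h0
  have h3 : (PowerSeries.X : FormalFun) ^ 2 ∣ σ coordY := by
    rw [hB, map_mul, map_mul, ofY_X, ← mul_assoc, ← sq]
    exact dvd_mul_right _ _
  have h4 := X_pow_dvd_map σ.symm.toAlgHom h3
  -- If `V` had no constant term, applying the order-preserving inverse of σ would make `y`
  -- divisible by `y ^ 2`.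
  change _ ∣ σ.symm (σ coordY) at h4
  rw [AlgEquiv.symm_apply_apply] at h4
  have h5 := X_pow_dvd_iff_cf.1 h4 1 one_lt_two 0
  rw [coordY_eq_ofY, cf_ofY, PowerSeries.coeff_one_X] at h5
  exact one_ne_zero h5

theorem commute_flow (p q : Multiplicative (ℂ × ℂ)) : Commute (M.flow p) (M.flow q) :=
  (Commute.all p q).map M.flow

theorem flow_commute_deckOne (p : Multiplicative (ℂ × ℂ)) : Commute (M.flow p) deckOne := by
  rw [M.deckOne_eq_flow]; exact commute_flow _ _

theorem flow_commute_deckTau (p : Multiplicative (ℂ × ℂ)) : Commute (M.flow p) M.deckTau := by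
  rw [M.deckTau_eq_flow]; exact commute_flow _ _

theorem exists_eq_rot_mul_flow_of_map_coordY (h1 : Commute σ deckOne) (hτ : Commute σ M.deckTau)
    {l : ℂˣ} (hl : (l : ℂ) ^ M.k = 1) (hy : σ coordY = (l : ℂ) • coordY) :
    ∃ c, M.IsSymmetry l ∧ σ = rot l * M.flow (Multiplicative.ofAdd (0, c)) := by
  obtain ⟨A, hA⟩ := exists_map_coordX h1 hτ
  have h2 := map_v₀ h1 hτ coordX
  have h3 : σ (M.v₀ coordX) = ofY (PowerSeries.rescale (l : ℂ)
      (PowerSeries.C M.τ * M.reflected * M.unitSeries)) := by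
    rw [v₀_coordX]
    exact map_ofY_of_map_coordY (σ := σ.toAlgHom) hy _
  rw [h3, hA, map_add, v₀_coordX, v₀_ofY, ← map_add] at h2
  have h4 := ofY_injective h2
  rw [map_mul, map_mul, rescale_unitSeries hl, rescale_C] at h4
  have h5 : PowerSeries.C M.τ * PowerSeries.rescale (l : ℂ) M.reflected
      = PowerSeries.C M.τ * M.reflected
        + PowerSeries.X ^ (M.k + 1) * PowerSeries.derivative ℂ A := by
    have h6 := M.one_add_mul_unitSeries
    linear_combination (1 + PowerSeries.C M.ν * PowerSeries.X ^ M.k) * h4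
      - (PowerSeries.C M.τ * PowerSeries.rescale (l : ℂ) M.reflected
        - PowerSeries.C M.τ * M.reflected
        - PowerSeries.X ^ (M.k + 1) * PowerSeries.derivative ℂ A) * h6
  -- In `h5` the two reflected polynomials have degree at most `k`, whereas the term in `A'` has
  -- order at least `k + 1`. Both contributions must therefore vanish separately.
  have h6 : PowerSeries.rescale (l : ℂ) M.reflected = M.reflected := by
    ext n
    by_cases hn : n ≤ M.k
    · have h7 := congrArg (PowerSeries.coeff n) h5
      rw [map_add, PowerSeries.coeff_X_pow_mul', if_neg (by omega), add_zero,
        PowerSeries.coeff_C_mul, PowerSeries.coeff_C_mul] at h7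
      exact mul_left_cancel₀ M.τ_ne_zero h7
    · rw [PowerSeries.coeff_rescale, coeff_reflected, if_neg hn, mul_zero]
  have h7 : PowerSeries.derivative ℂ A = 0 := by
    rw [h6] at h5
    refine (mul_eq_zero.1 (left_eq_add.1 h5)).resolve_left (pow_ne_zero _ PowerSeries.X_ne_zero)
  have h8 : A = PowerSeries.C (PowerSeries.coeff 0 A) := by
    ext n
    rcases n with _ | n
    · simp
    · have h9 := congrArg (PowerSeries.coeff n) h7
      rw [PowerSeries.coeff_derivative, map_zero] at h9
      rw [PowerSeries.coeff_C, if_neg (Nat.succ_ne_zero n)]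
      exact (mul_eq_zero.1 h9).resolve_right (Nat.cast_add_one_ne_zero n)
  refine ⟨PowerSeries.coeff 0 A, isSymmetry_iff.2 ⟨hl, h6⟩, ?_⟩
  rw [← shift_eq_flow]
  refine algEquiv_ext ?_ ?_
  · rw [AlgEquiv.mul_apply, shift_coordX, map_add, rot_coordX, AlgEquiv.commutes, hA, h8, ofY_C,
      ← h8]
  · rw [AlgEquiv.mul_apply, shift_coordY, rot_coordY, hy]

/-- An automorphism commuting with the deck transformations is a rotation composed with the flow
of a combination of `v₀` and `∂_x`. -/
theorem exists_eq_rot_mul_flow (h1 : Commute σ deckOne) (hτ : Commute σ M.deckTau) :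
    ∃ l p, M.IsSymmetry l ∧ σ = rot l * M.flow p := by
  obtain ⟨V, hV, hV0⟩ := exists_map_coordY_eq_X_mul h1 hτ
  have hVk := pow_constantCoeff_eq_one (equation_of_commute (map_v₀ h1 hτ coordY) hV) hV0
  set l := PowerSeries.coeff 0 V with hl
  -- Composition with `exp (s v₀)` changes the coefficient of index `k` into `V_k + s l ^ (k + 1) =
  -- V_k + s l`; this `s` makes it zero.
  set s : ℂ := -(PowerSeries.coeff M.k V) / l with hs
  set σ' := σ * M.flow (Multiplicative.ofAdd (s, 0)) with hσ'
  have h1' : Commute σ' deckOne := h1.mul_left (flow_commute_deckOne _)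
  have hτ' : Commute σ' M.deckTau := hτ.mul_left (flow_commute_deckTau _)
  obtain ⟨V', hV', hV0'⟩ := exists_map_coordY_eq_X_mul h1' hτ'
  have hcoeff : ∀ n ≤ M.k, PowerSeries.coeff n V'
      = PowerSeries.coeff n V + s * PowerSeries.coeff n (PowerSeries.X ^ M.k * V ^ (M.k + 1)) := by
    intro n hn
    have h2 := X_pow_dvd_map σ.toAlgHom (M.flow_coordY_dvd s 0)
    change _ ∣ σ _ at h2
    have h3 := X_pow_dvd_iff_cf.1 h2 (n + 1) (by omega) 0
    rw [map_sub, ← AlgEquiv.mul_apply, ← hσ', hV', map_add, map_smul, map_pow, hV, cf_sub, cf_add,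
      cf_smul, ← map_pow, cf_ofY, cf_ofY, cf_ofY, PowerSeries.coeff_succ_X_mul,
      PowerSeries.coeff_succ_X_mul, mul_pow, pow_succ', mul_assoc, PowerSeries.coeff_succ_X_mul,
      sub_eq_zero] at h3
    exact h3
  have h0 : PowerSeries.coeff 0 V' = l := by
    rw [hcoeff 0 (Nat.zero_le _), PowerSeries.coeff_X_pow_mul',
      if_neg (by have := M.k_pos; omega), mul_zero, add_zero]
  have hk : PowerSeries.coeff M.k V' = 0 := by
    have h2 := PowerSeries.coeff_X_pow_mul (V ^ (M.k + 1)) M.k 0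
    rw [zero_add] at h2
    rw [hcoeff M.k le_rfl, h2, PowerSeries.coeff_zero_eq_constantCoeff_apply, map_pow,
      ← PowerSeries.coeff_zero_eq_constantCoeff_apply, ← hl, pow_succ, hVk, one_mul, hs,
      div_mul_cancel₀ _ hV0, add_neg_cancel]
  have hC := eq_C_of_equation (equation_of_commute (map_v₀ h1' hτ' coordY) hV') hV0' hk
  have hy : σ' coordY = ((Units.mk0 l hV0 : ℂˣ) : ℂ) • coordY := by
    rw [hV', hC, h0, map_mul, ofY_C, ← coordY_eq_ofY, mul_comm, ← Algebra.smul_def,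
      Units.val_mk0]
  obtain ⟨c, hsym, hc⟩ := exists_eq_rot_mul_flow_of_map_coordY h1' hτ' hVk hy
  refine ⟨_, Multiplicative.ofAdd (0, c) * (Multiplicative.ofAdd (s, 0))⁻¹, hsym, ?_⟩
  rw [map_mul, map_inv, ← mul_assoc, ← hc, hσ', mul_inv_cancel_right]

theorem IsSymmetry.commute_rot_flow {l : ℂˣ} (hl : M.IsSymmetry l)
    (p : Multiplicative (ℂ × ℂ)) : Commute (rot l) (M.flow p) := by
  ext1 f
  obtain ⟨⟨s, c⟩, rfl⟩ := Multiplicative.ofAdd.surjective p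
  rw [AlgEquiv.mul_apply, AlgEquiv.mul_apply, flow_apply, flow_apply, hl.rot_lieSeries,
    ← AlgEquiv.mul_apply, ← shift_mul_rot, AlgEquiv.mul_apply]

theorem rot_mul_flow_mem_lifts {l : ℂˣ} (hl : M.IsSymmetry l) (p : Multiplicative (ℂ × ℂ)) :
    rot l * M.flow p ∈ M.lifts := by
  constructor
  · have hcomm : ∀ ρ ∈ M.deckGroup, (rot l * M.flow p) * ρ * (rot l * M.flow p)⁻¹ = ρ := by
      intro ρ hρ
      obtain ⟨a, b, rfl⟩ := M.mem_deckGroup_iff.1 hρ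
      rw [mul_inv_eq_iff_eq_mul]
      exact ((hl.commute_rot_flow _).mul_left (commute_flow _ _)).eq
    refine Subgroup.mem_normalizer_iff.2 fun ρ => ⟨fun h => ?_, fun h => ?_⟩
    · rw [hcomm ρ h]; exact h
    · have h2 := hcomm _ h
      have h3 := mul_left_cancel (mul_right_cancel h2)
      rwa [h3] at h
  · obtain ⟨⟨s, c⟩, rfl⟩ := Multiplicative.ofAdd.surjective p
    refine ⟨(c : M.Curve), fun p => ⟨p + c, rfl, fun f => ?_⟩⟩
    change cf 0 (rot l (M.flow _ f)) p = cf 0 f (p + c)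
    rw [cf_rot, cf_zero_flow, pow_zero, one_mul]

theorem mem_lifts_iff : σ ∈ M.lifts ↔ ∃ l p, M.IsSymmetry l ∧ σ = rot l * M.flow p :=
  ⟨fun h => exists_eq_rot_mul_flow (commute_deckOne_of_mem_lifts h)
      (commute_deckTau_of_mem_lifts h),
    by rintro ⟨l, p, hl, rfl⟩; exact rot_mul_flow_mem_lifts hl p⟩

/-- The parameters are visible in the components: `c` in `x` along `{y = 0}`, `l` in the coefficient
of `y`, and `s` in that of `y ^ (k + 1)`. -/
theorem rot_mul_flow_eq_one {l : ℂˣ} {p : Multiplicative (ℂ × ℂ)} (h : rot l * M.flow p = 1) :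
    l = 1 ∧ p = 1 := by
  obtain ⟨⟨s, c⟩, rfl⟩ := Multiplicative.ofAdd.surjective p
  have h1 : ∀ f, rot l (M.flow (Multiplicative.ofAdd (s, c)) f) = f := fun f =>
    congrArg (fun φ : FormalFun ≃ₐ[ℂ] FormalFun => φ f) h
  have hc : c = 0 := by
    have h2 := congrArg (fun f => cf 0 f 0) (h1 coordX)
    simpa [cf_rot, cf_zero_flow, cf_coordX] using h2
  have h3 : ∀ n < M.k + 2, (l : ℂ) ^ n * (PowerSeries.coeff n (PowerSeries.X : PowerSeries ℂ)
      + s * PowerSeries.coeff n ((PowerSeries.X : PowerSeries ℂ) ^ (M.k + 1)))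
        = PowerSeries.coeff n (PowerSeries.X : PowerSeries ℂ) := by
    intro n hn
    have h4 := X_pow_dvd_iff_cf.1 (M.flow_coordY_dvd s c) n hn 0
    have h5 := congrArg (fun f => cf n f 0) (h1 coordY)
    simp only [cf_rot] at h5
    rw [cf_sub, sub_eq_zero] at h4
    rw [h4, cf_add, cf_smul, coordY_eq_ofY, ← map_pow, cf_ofY, cf_ofY] at h5
    exact h5
  have hk := M.k_pos
  have hl : (l : ℂ) = 1 := by
    have h4 := h3 1 (by omega)
    rwa [PowerSeries.coeff_one_X, PowerSeries.coeff_X_pow, if_neg (by omega), mul_zero, add_zero,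
      mul_one, pow_one] at h4
  have hs : s = 0 := by
    have h4 := h3 (M.k + 1) (by omega)
    rwa [PowerSeries.coeff_X, PowerSeries.coeff_X_pow, if_neg (by omega), if_pos rfl, hl, one_pow,
      one_mul, zero_add, mul_one] at h4
  exact ⟨Units.ext hl, by rw [hs, hc]; rfl⟩

/-! ### The order of the group of rotations -/

theorem comp_C_mul_X_eq_iff (P : ℂ[X]) (l : ℂ) :
    P.comp (Polynomial.C l * Polynomial.X) = P ↔ ∀ j, P.coeff j ≠ 0 → l ^ j = 1 := by
  rw [Polynomial.ext_iff]
  refine forall_congr' fun j => ?_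
  rw [Polynomial.comp_C_mul_X_coeff]
  constructor
  · intro h hj
    exact mul_left_cancel₀ hj (by rw [h, mul_one])
  · intro h
    by_cases hj : P.coeff j = 0
    · rw [hj, zero_mul]
    · rw [h hj, mul_one]

variable (M)

/-- Invariance means `ζ ^ j = 1` for each exponent `j` of `P`; testing it on a primitive `d`-th root
gives `d ∣ j`. -/
theorem forall_comp_eq_iff {d : ℕ} (hd : 0 < d) :
    (∀ ζ : ℂ, ζ ^ d = 1 → M.P.comp (Polynomial.C ζ * Polynomial.X) = M.P) ↔
      d ∣ M.P.support.gcd id := by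
  rw [Finset.dvd_gcd_iff]
  simp only [comp_C_mul_X_eq_iff, Polynomial.mem_support_iff, id]
  constructor
  · intro h j hj
    have hp := Complex.isPrimitiveRoot_exp d hd.ne'
    exact hp.dvd_of_pow_eq_one j (h _ hp.pow_eq_one j hj)
  · intro h ζ hζ j hj
    obtain ⟨e, he⟩ := h j hj
    rw [he, pow_mul, hζ, one_pow]

theorem rotationOrder_eq (hP : M.P.natDegree ≠ 0) : M.rotationOrder = M.P.support.gcd id := by
  -- The degree is a nonzero exponent, so the gcd is positive and bounds the set of admissible `d`.
  -- The supremum is thus a true maximum and not the default value of `sSup`.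
  have hpos : 0 < M.P.support.gcd id := by
    refine Nat.pos_of_ne_zero fun h => hP ?_
    have h1 := Finset.gcd_eq_zero_iff.1 h M.P.natDegree
    refine h1 (Polynomial.natDegree_mem_support_of_nonzero ?_)
    rintro h0
    rw [h0] at hP
    exact hP Polynomial.natDegree_zero
  have hset : {d : ℕ | 0 < d ∧ ∀ ζ : ℂ, ζ ^ d = 1 →
      M.P.comp (Polynomial.C ζ * Polynomial.X) = M.P} = {d : ℕ | d ∣ M.P.support.gcd id} := by
    ext d
    constructor
    · rintro ⟨hd, h⟩
      exact (M.forall_comp_eq_iff hd).1 h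
    · intro h
      have hd := Nat.pos_of_dvd_of_pos h hpos
      exact ⟨hd, (M.forall_comp_eq_iff hd).2 h⟩
  rw [rotationOrder, hset]
  refine IsGreatest.csSup_eq ⟨dvd_rfl, fun d hd => Nat.le_of_dvd hpos hd⟩

theorem symmetryOrder_dvd : M.symmetryOrder ∣ M.k := by
  rw [symmetryOrder]
  split_ifs
  · exact dvd_rfl
  · exact Nat.gcd_dvd_left _ _

theorem symmetryOrder_pos : 0 < M.symmetryOrder :=
  Nat.pos_of_dvd_of_pos M.symmetryOrder_dvd M.k_pos

theorem isSymmetry_iff_pow_eq_one (l : ℂˣ) : M.IsSymmetry l ↔ l ^ M.symmetryOrder = 1 := by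
  have hpow : ∀ n : ℕ, (l : ℂ) ^ n = 1 ↔ orderOf l ∣ n := fun n => by
    rw [orderOf_dvd_iff_pow_eq_one, Units.ext_iff, Units.val_pow_eq_pow_val, Units.val_one]
  rw [← orderOf_dvd_iff_pow_eq_one, IsSymmetry, symmetryOrder]
  simp only [hpow]
  split_ifs with hP
  · refine and_iff_left_of_imp fun _ j hj => ?_
    have h1 := Polynomial.le_natDegree_of_ne_zero hj
    obtain rfl : j = 0 := by omega
    exact dvd_zero _
  · rw [M.rotationOrder_eq hP, Nat.dvd_gcd_iff, Finset.dvd_gcd_iff]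
    simp only [Polynomial.mem_support_iff, id]

end NormalForm

/-! ### Convergence -/

/-- The coefficients of `g` grow at most geometrically. -/
def GeomBounded (g : PowerSeries ℂ) : Prop :=
  ∃ K : ℝ, 0 < K ∧ ∀ n, ‖PowerSeries.coeff n g‖ ≤ K ^ (n + 1)

namespace GeomBounded

variable {g h : PowerSeries ℂ}

theorem add (hg : GeomBounded g) (hh : GeomBounded h) : GeomBounded (g + h) := by
  obtain ⟨K, hK, hg⟩ := hg
  obtain ⟨L, hL, hh⟩ := hh
  refine ⟨K + L, add_pos hK hL, fun n => ?_⟩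
  rw [map_add]
  exact (norm_add_le _ _).trans ((add_le_add (hg n) (hh n)).trans
    (pow_add_pow_le hK.le hL.le (Nat.succ_ne_zero n)))

theorem rescale (hg : GeomBounded g) (l : ℂ) : GeomBounded (PowerSeries.rescale l g) := by
  obtain ⟨K, hK, hg⟩ := hg
  have hl : 0 < ‖l‖ + 1 := by positivity
  refine ⟨(‖l‖ + 1) * K, by positivity, fun n => ?_⟩
  rw [PowerSeries.coeff_rescale, norm_mul, norm_pow, mul_pow]
  refine mul_le_mul ?_ (hg n) (norm_nonneg _) (by positivity)
  calc ‖l‖ ^ n ≤ (‖l‖ + 1) ^ n := pow_le_pow_left₀ (norm_nonneg _) (by linarith) n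
    _ ≤ (‖l‖ + 1) ^ (n + 1) :=
      pow_le_pow_right₀ (by linarith [norm_nonneg l]) (Nat.le_succ n)

theorem C (c : ℂ) : GeomBounded (PowerSeries.C c) := by
  refine ⟨‖c‖ + 1, by positivity, fun n => ?_⟩
  rw [PowerSeries.coeff_C]
  split_ifs with h
  · rw [h, zero_add, pow_one]; linarith
  · rw [norm_zero]; positivity

theorem X : GeomBounded PowerSeries.X := by
  refine ⟨1, one_pos, fun n => ?_⟩
  rw [PowerSeries.coeff_X, one_pow]
  split_ifs <;> simp

/-- The bound gives a positive radius of convergence, and the sum is holomorphic on ℂ times a disc.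
The cases `a = 1` and `a = 0` serve the `x`- and `y`-components of a lift. -/
theorem converges (hg : GeomBounded g) (a : ℂ) : Converges (a • coordX + ofY g) := by
  obtain ⟨K, hK, hg⟩ := hg
  set p := FormalMultilinearSeries.ofScalars ℂ (fun n => PowerSeries.coeff n g) with hp
  have hr : 0 < p.radius := by
    let r : NNReal := ⟨K⁻¹, by positivity⟩
    have h1 : (r : ENNReal) ≤ p.radius := by
      refine p.le_radius_of_bound K fun n => ?_
      rw [hp, FormalMultilinearSeries.ofScalars_norm]
      refine (mul_le_mul_of_nonneg_right (hg n) (by positivity)).trans_eq ?_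
      change K ^ (n + 1) * K⁻¹ ^ n = K
      rw [pow_succ, mul_right_comm, ← mul_pow, mul_inv_cancel₀ hK.ne', one_pow, one_mul]
    refine lt_of_lt_of_le ?_ h1
    rw [ENNReal.coe_pos]
    exact inv_pos.2 hK
  have hball := p.hasFPowerSeriesOnBall hr
  refine ⟨Set.univ ×ˢ Metric.eball 0 p.radius, fun q => a * q.1 + p.sum q.2,
    isOpen_univ.prod Metric.isOpen_eball, fun x => ⟨trivial, Metric.mem_eball_self hr⟩, ?_,
    fun x n => ?_⟩
  · refine DifferentiableOn.add (by fun_prop) ?_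
    exact hball.differentiableOn.comp differentiableOn_snd fun q hq => hq.2
  · have h1 := hball.factorial_smul 1 n
    rw [← iteratedDeriv_eq_iteratedFDeriv, hp, FormalMultilinearSeries.ofScalars_apply_eq,
      one_pow, smul_eq_mul, mul_one, nsmul_eq_mul] at h1
    rw [cf_add, cf_smul, cf_coordX, cf_ofY]
    rcases Nat.eq_zero_or_pos n with rfl | hn
    · rw [iteratedDeriv_zero] at h1 ⊢
      simp only [if_true]
      rw [← h1]
      simp
    · refine (iteratedDeriv_const_add hn (a * x)).trans ?_
      rw [← h1, if_neg hn.ne', mul_zero, zero_add]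

end GeomBounded

/-! ### Growth of the coefficients of `exp (s v₀)` -/

namespace NormalForm

variable (M : NormalForm)

theorem norm_coeff_unitSeries_le (n : ℕ) :
    ‖PowerSeries.coeff n M.unitSeries‖ ≤ (‖M.ν‖ + 1) ^ n := by
  induction n using Nat.strong_induction_on with
  | _ n ih =>
    have h1 : M.unitSeries = 1 - PowerSeries.X ^ M.k * (PowerSeries.C M.ν * M.unitSeries) := by
      linear_combination M.one_add_mul_unitSeries
    have h2 := congrArg (PowerSeries.coeff n) h1
    have hk := M.k_pos
    rw [map_sub, PowerSeries.coeff_one, PowerSeries.coeff_X_pow_mul', PowerSeries.coeff_C_mul] at h2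
    have hR : 1 ≤ ‖M.ν‖ + 1 := by linarith [norm_nonneg M.ν]
    rw [h2]
    by_cases hn : n = 0
    · rw [if_pos hn, if_neg (by omega), hn]
      simp
    · rw [if_neg hn, zero_sub, norm_neg]
      split_ifs with hkn
      · rw [norm_mul]
        calc ‖M.ν‖ * ‖PowerSeries.coeff (n - M.k) M.unitSeries‖
            ≤ (‖M.ν‖ + 1) * (‖M.ν‖ + 1) ^ (n - M.k) :=
              mul_le_mul (by linarith) (ih _ (by omega)) (norm_nonneg _) (by positivity)
          _ = (‖M.ν‖ + 1) ^ (n - M.k + 1) := (pow_succ' _ _).symm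
          _ ≤ (‖M.ν‖ + 1) ^ n := pow_le_pow_right₀ hR (by omega)
      · rw [norm_zero]; positivity

/-- The vector field `v₀` on power series in `y`. -/
def v₀Y (g : PowerSeries ℂ) : PowerSeries ℂ :=
  PowerSeries.X ^ (M.k + 1) * M.unitSeries * PowerSeries.derivative ℂ g

theorem v₀_iterate_ofY (m : ℕ) (g : PowerSeries ℂ) :
    (M.v₀)^[m] (ofY g) = ofY (M.v₀Y^[m] g) := by
  induction m with
  | zero => rfl
  | succ m ih => rw [Function.iterate_succ_apply', ih, v₀_ofY, Function.iterate_succ_apply', v₀Y]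

/-- `v₀` is `y ∂_y`, which costs a factor at most `n`, followed by multiplication by `y ^ k / (1 + ν
y ^ k)`, whose coefficients are bounded by `R ^ i`. The factor 2 in `2 R` absorbs the convolution,
as `∑ 2 ^ j` over `j < n` is at most `2 ^ n`; the term `j = n` is absent because the multiplier
vanishes at `y = 0`. -/
theorem norm_coeff_v₀Y_le {C R : ℝ} (hC : 1 ≤ C) (hR : ‖M.ν‖ + 1 ≤ R) {m : ℕ}
    {g : PowerSeries ℂ}
    (hg : ∀ n, ‖PowerSeries.coeff n g‖ ≤ (n * C) ^ m * (2 * R) ^ n) (n : ℕ) :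
    ‖PowerSeries.coeff n (M.v₀Y g)‖ ≤ (n * C) ^ (m + 1) * (2 * R) ^ n := by
  have hR0 : 1 ≤ R := by linarith [norm_nonneg M.ν]
  have h1 : M.v₀Y g = (PowerSeries.X * PowerSeries.derivative ℂ g)
      * (PowerSeries.X ^ M.k * M.unitSeries) := by
    rw [v₀Y]; ring
  have h2 : ∀ j, PowerSeries.coeff j (PowerSeries.X * PowerSeries.derivative ℂ g)
      = j * PowerSeries.coeff j g := by
    rintro (_ | j)
    · simp
    · rw [PowerSeries.coeff_succ_X_mul, PowerSeries.coeff_derivative]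
      push_cast; ring
  have h3 : ∀ i, ‖PowerSeries.coeff i (PowerSeries.X ^ M.k * M.unitSeries)‖ ≤ R ^ i := by
    intro i
    rw [PowerSeries.coeff_X_pow_mul']
    split_ifs with hi
    · refine (M.norm_coeff_unitSeries_le _).trans ?_
      exact (pow_le_pow_left₀ (by positivity) hR _).trans
        (pow_le_pow_right₀ hR0 (Nat.sub_le _ _))
    · rw [norm_zero]; positivity
  have h4 : PowerSeries.coeff 0 (PowerSeries.X ^ M.k * M.unitSeries) = 0 := by
    rw [PowerSeries.coeff_X_pow_mul', if_neg (by have := M.k_pos; omega)]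
  rw [h1, PowerSeries.coeff_mul, Finset.Nat.sum_antidiagonal_eq_sum_range_succ_mk,
    Finset.sum_range_succ, Nat.sub_self, h4, mul_zero, add_zero]
  have hC0 : 0 < C := by linarith
  calc _ ≤ ∑ j ∈ Finset.range n, ((n : ℝ) * C) ^ (m + 1) * R ^ n * 2 ^ j := by
        refine norm_sum_le_of_le _ fun j hj => ?_
        have hjn : j < n := Finset.mem_range.1 hj
        have hjn' : (j : ℝ) ≤ n := by exact_mod_cast hjn.le
        rw [norm_mul, h2, norm_mul, Complex.norm_natCast]
        calc (j : ℝ) * ‖PowerSeries.coeff j g‖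
              * ‖PowerSeries.coeff (n - j) (PowerSeries.X ^ M.k * M.unitSeries)‖
            ≤ (n * C) * ((n * C) ^ m * (2 * R) ^ j) * R ^ (n - j) := by
              have h5 : (j : ℝ) ≤ n * C := by nlinarith [(Nat.cast_nonneg n : (0 : ℝ) ≤ n)]
              have h6 : ((j : ℝ) * C) ^ m ≤ (n * C) ^ m :=
                pow_le_pow_left₀ (by positivity) (by gcongr) m
              have h7 : ‖PowerSeries.coeff j g‖ ≤ (n * C) ^ m * (2 * R) ^ j :=
                (hg j).trans (mul_le_mul_of_nonneg_right h6 (by positivity))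
              gcongr
              exact h3 _
          _ = (n * C) ^ (m + 1) * R ^ n * 2 ^ j := by
              rw [show n = j + (n - j) by omega, pow_add R j (n - j), Nat.add_sub_cancel_left,
                mul_pow 2 R]
              ring
    _ ≤ (n * C) ^ (m + 1) * R ^ n * 2 ^ n := by
        rw [← Finset.mul_sum]
        refine mul_le_mul_of_nonneg_left ?_ (by positivity)
        rw [geom_sum_eq (by norm_num)]
        norm_num
    _ = _ := by rw [mul_pow 2 R]; ring

/-- The Lie series of a function whose derivative along `v₀` is a convergent function of `y`
differs from it by a convergent function of `y`. -/
theorem exists_geomBounded_lieSeries {f : FormalFun} {g : PowerSeries ℂ} (hf : M.v₀ f = ofY g)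
    (hg : ∃ C : ℝ, ∀ n, ‖PowerSeries.coeff n g‖ ≤ n * C * (2 * (‖M.ν‖ + 1)) ^ n) (s : ℂ) :
    ∃ h, GeomBounded h ∧ lieSeries (s • M.v₀) f = f + ofY h := by
  obtain ⟨C₀, hC₀⟩ := hg
  set C := max C₀ 1 with hC
  set R := ‖M.ν‖ + 1 with hR
  have hR0 : 1 ≤ R := by linarith [norm_nonneg M.ν]
  have hC1 : 1 ≤ C := le_max_right _ _
  have hbound : ∀ m n, ‖PowerSeries.coeff n (M.v₀Y^[m] g)‖ ≤ (n * C) ^ (m + 1) * (2 * R) ^ n := by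
    intro m
    induction m with
    | zero =>
      intro n
      refine (hC₀ n).trans ?_
      rw [zero_add, pow_one]
      gcongr
      exact le_max_left _ _
    | succ m ih =>
      rw [Function.iterate_succ_apply']
      exact M.norm_coeff_v₀Y_le hC1 le_rfl ih
  -- In degree `n` the Lie series stops at `m = n`; removing the term `f` leaves the iterates of
  -- `v₀` on `g`. The bounds `(n C) ^ (m + 1) / (m + 1)!` sum to at most an exponential in `n`, that
  -- is, to geometric growth.
  refine ⟨PowerSeries.mk fun n => ∑ m ∈ Finset.range n, s ^ (m + 1) *
    (((m + 1).factorial : ℂ)⁻¹ * PowerSeries.coeff n (M.v₀Y^[m] g)), ?_, ?_⟩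
  · have hexp : 1 ≤ Real.exp (‖s‖ * C) := Real.one_le_exp (by positivity)
    refine ⟨Real.exp (‖s‖ * C) * (2 * R), by positivity, fun n => ?_⟩
    rw [PowerSeries.coeff_mk]
    calc _ ≤ ∑ m ∈ Finset.range n, (‖s‖ * (n * C)) ^ (m + 1) / ((m + 1).factorial : ℝ)
            * (2 * R) ^ n := by
          refine norm_sum_le_of_le _ fun m _ => ?_
          rw [norm_mul, norm_mul, norm_pow, norm_inv, Complex.norm_natCast]
          refine (mul_le_mul_of_nonneg_left (mul_le_mul_of_nonneg_left (hbound m n)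
            (by positivity)) (by positivity)).trans_eq ?_
          rw [mul_pow ‖s‖]
          ring
      _ ≤ Real.exp (‖s‖ * (n * C)) * (2 * R) ^ n := by
          rw [← Finset.sum_mul]
          refine mul_le_mul_of_nonneg_right ?_ (by positivity)
          have h1 := Real.sum_le_exp_of_nonneg
            (show 0 ≤ ‖s‖ * (n * C) by positivity) (n + 1)
          rw [Finset.sum_range_succ'] at h1
          refine le_trans ?_ h1
          simp
      _ = (Real.exp (‖s‖ * C) * (2 * R)) ^ n := by
          rw [mul_pow _ (2 * R), ← Real.exp_nat_mul]
          ring_nf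
      _ ≤ _ := pow_le_pow_right₀ (by nlinarith) (Nat.le_succ n)
  · refine ext_cf fun n x => ?_
    rw [M.v₀_raisesOrder.cf_lieSeries_smul (Nat.lt_succ_self n), Finset.sum_range_succ', cf_add,
      cf_ofY, PowerSeries.coeff_mk, add_comm]
    simp only [Function.iterate_succ_apply, hf, v₀_iterate_ofY, cf_ofY]
    simp

theorem norm_coeff_X_pow_mul_unitSeries_le (n : ℕ) :
    ‖PowerSeries.coeff n (PowerSeries.X ^ (M.k + 1) * M.unitSeries)‖
      ≤ n * 1 * (2 * (‖M.ν‖ + 1)) ^ n := by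
  have hR0 : 1 ≤ ‖M.ν‖ + 1 := by linarith [norm_nonneg M.ν]
  rw [PowerSeries.coeff_X_pow_mul']
  split_ifs with hn
  · have h1 : (1 : ℝ) ≤ n := by exact_mod_cast (by omega : 1 ≤ n)
    calc _ ≤ (‖M.ν‖ + 1) ^ (n - (M.k + 1)) := M.norm_coeff_unitSeries_le _
      _ ≤ (‖M.ν‖ + 1) ^ n := pow_le_pow_right₀ hR0 (Nat.sub_le _ _)
      _ ≤ (2 * (‖M.ν‖ + 1)) ^ n := pow_le_pow_left₀ (by positivity) (by linarith) n
      _ ≤ n * 1 * (2 * (‖M.ν‖ + 1)) ^ n := by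
        rw [mul_one]
        exact le_mul_of_one_le_left (by positivity) h1
  · rw [norm_zero]; positivity

theorem exists_norm_coeff_reflected_mul_le : ∃ C : ℝ, ∀ n,
    ‖PowerSeries.coeff n (PowerSeries.C M.τ * M.reflected * M.unitSeries)‖
      ≤ n * C * (2 * (‖M.ν‖ + 1)) ^ n := by
  have hR0 : 1 ≤ ‖M.ν‖ + 1 := by linarith [norm_nonneg M.ν]
  set S : ℝ := ∑ i ∈ Finset.range (M.k + 1), ‖PowerSeries.coeff i M.reflected‖ with hS
  have hS0 : 0 ≤ S := Finset.sum_nonneg fun _ _ => norm_nonneg _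
  have hle : ∀ i, ‖PowerSeries.coeff i M.reflected‖ ≤ S := by
    intro i
    by_cases hi : i ≤ M.k
    · exact Finset.single_le_sum (f := fun i => ‖PowerSeries.coeff i M.reflected‖)
        (fun _ _ => norm_nonneg _) (Finset.mem_range.2 (Nat.lt_succ_of_le hi))
    · rw [coeff_reflected, if_neg hi, norm_zero]; exact hS0
  refine ⟨‖M.τ‖ * (2 * S), fun n => ?_⟩
  rw [mul_assoc, PowerSeries.coeff_C_mul, norm_mul]
  -- The factor `n` in the bound requires a zero constant coefficient, which is where `deg P < k`
  -- enters; for the other degrees, the convolution has `n + 2 ≤ 2 (n + 1)` terms.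
  rcases n with _ | n
  · have h0 : PowerSeries.coeff 0 M.reflected = 0 := by
      rw [coeff_reflected, if_pos (Nat.zero_le _)]
      exact Polynomial.coeff_eq_zero_of_degree_lt M.degree_lt
    rw [PowerSeries.coeff_mul]
    simp [h0]
  · have h1 : ‖PowerSeries.coeff (n + 1) (M.reflected * M.unitSeries)‖
        ≤ ∑ _i ∈ Finset.range (n + 1 + 1), S * (‖M.ν‖ + 1) ^ (n + 1) := by
      rw [PowerSeries.coeff_mul, Finset.Nat.sum_antidiagonal_eq_sum_range_succ_mk]
      refine norm_sum_le_of_le _ fun i _ => ?_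
      rw [norm_mul]
      refine mul_le_mul (hle i) ?_ (norm_nonneg _) hS0
      exact (M.norm_coeff_unitSeries_le _).trans (pow_le_pow_right₀ hR0 (Nat.sub_le _ _))
    rw [Finset.sum_const, Finset.card_range, nsmul_eq_mul] at h1
    have h2 : ((n + 1 + 1 : ℕ) : ℝ) ≤ (n + 1 : ℕ) * 2 := by
      push_cast
      linarith [(Nat.cast_nonneg n : (0 : ℝ) ≤ n)]
    have h3 : (‖M.ν‖ + 1) ^ (n + 1) ≤ (2 * (‖M.ν‖ + 1)) ^ (n + 1) :=
      pow_le_pow_left₀ (by positivity) (by linarith) _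
    calc _ ≤ ‖M.τ‖ * (((n + 1 : ℕ) * 2) * (S * (2 * (‖M.ν‖ + 1)) ^ (n + 1))) := by
          refine mul_le_mul_of_nonneg_left (h1.trans ?_) (norm_nonneg _)
          gcongr
      _ = _ := by ring

variable {M}

theorem convergentDiffeo_of_mem_lifts {σ : FormalFun ≃ₐ[ℂ] FormalFun} (hσ : σ ∈ M.lifts) :
    ConvergentDiffeo σ := by
  obtain ⟨l, p, hl, rfl⟩ := mem_lifts_iff.1 hσ
  obtain ⟨⟨s, c⟩, rfl⟩ := Multiplicative.ofAdd.surjective p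
  obtain ⟨g, hg, hgx⟩ := M.exists_geomBounded_lieSeries M.v₀_coordX
    M.exists_norm_coeff_reflected_mul_le s
  obtain ⟨h, hh, hhy⟩ := M.exists_geomBounded_lieSeries (f := coordY)
    (g := PowerSeries.X ^ (M.k + 1) * M.unitSeries)
    (by rw [coordY_eq_ofY, v₀_ofY, PowerSeries.derivative_X, mul_one])
    ⟨1, M.norm_coeff_X_pow_mul_unitSeries_le⟩ s
  constructor
  · have h1 := (((GeomBounded.C c).add hg).rescale (l : ℂ)).converges 1
    convert h1 using 1
    rw [AlgEquiv.mul_apply, flow_apply, shift_coordX, RaisesOrder.lieSeries_add,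
      RaisesOrder.lieSeries_algebraMap, hgx, ← rot_ofY, one_smul, map_add ofY, ofY_C, map_add,
      map_add, map_add, rot_coordX]
    ring
  · have h1 := ((GeomBounded.X.add hh).rescale (l : ℂ)).converges 0
    convert h1 using 1
    rw [AlgEquiv.mul_apply, flow_apply, shift_coordY, hhy, ← rot_ofY, zero_smul, zero_add,
      map_add ofY, ← coordY_eq_ofY]

end NormalForm

/-! ### The automorphism group -/

theorem exists_mulEquiv_of_ker_eq {G H K : Type*} [Group G] [Group H] [Group K] (φ : G →* H)
    (ψ : G →* K) (hφ : Function.Surjective φ) (hψ : Function.Surjective ψ)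
    (hker : φ.ker = ψ.ker) : ∃ e : H ≃* K, ∀ g, e (φ g) = ψ g := by
  refine ⟨(QuotientGroup.quotientKerEquivOfSurjective φ hφ).symm.trans
    ((QuotientGroup.quotientMulEquivOfEq hker).trans
      (QuotientGroup.quotientKerEquivOfSurjective ψ hψ)), fun g => ?_⟩
  have h : (QuotientGroup.quotientKerEquivOfSurjective φ hφ).symm (φ g) = (g : G ⧸ φ.ker) :=
    (MulEquiv.symm_apply_eq _).2 rfl
  rw [MulEquiv.trans_apply, h]
  rfl

namespace NormalForm

variable (M : NormalForm)

/-- The lift `rot l * flow p` attached to a root of unity `l` and to `p ∈ ℂ × ℂ`. -/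
def liftHom : rootsOfUnity M.symmetryOrder ℂ × Multiplicative (ℂ × ℂ) →* M.lifts where
  toFun q := ⟨rot q.1 * M.flow q.2, rot_mul_flow_mem_lifts
    ((M.isSymmetry_iff_pow_eq_one _).2 ((mem_rootsOfUnity _ _).1 q.1.2)) q.2⟩
  map_one' := by
    apply Subtype.ext
    change rot 1 * M.flow 1 = 1
    rw [map_one, mul_one]
    exact algEquiv_ext (rot_coordX 1) (by rw [rot_coordY, Units.val_one, one_smul]; rfl)
  map_mul' q r := by
    apply Subtype.ext
    change rot (q.1 * r.1 : ℂˣ) * M.flow (q.2 * r.2)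
      = rot q.1 * M.flow q.2 * (rot r.1 * M.flow r.2)
    have h := ((M.isSymmetry_iff_pow_eq_one _).2
      ((mem_rootsOfUnity _ _).1 r.1.2)).commute_rot_flow q.2
    rw [rot_mul, map_mul, mul_assoc, mul_assoc, ← mul_assoc (M.flow q.2), ← h.eq, mul_assoc]

theorem coe_liftHom (l : rootsOfUnity M.symmetryOrder ℂ) (p : Multiplicative (ℂ × ℂ)) :
    (M.liftHom (l, p) : FormalFun ≃ₐ[ℂ] FormalFun) = rot l * M.flow p := rfl

theorem coe_liftHom_one (p : Multiplicative (ℂ × ℂ)) :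
    (M.liftHom (1, p) : FormalFun ≃ₐ[ℂ] FormalFun) = M.flow p := by
  have h := M.liftHom.map_one
  have h1 := congrArg (Subtype.val) h
  change rot 1 * M.flow 1 = 1 at h1
  rw [map_one, mul_one] at h1
  rw [coe_liftHom, OneMemClass.coe_one, h1, one_mul]

theorem liftHom_surjective : Function.Surjective M.liftHom := by
  rintro ⟨σ, hσ⟩
  obtain ⟨l, p, hl, rfl⟩ := mem_lifts_iff.1 hσ
  exact ⟨(⟨l, (mem_rootsOfUnity _ _).2 ((M.isSymmetry_iff_pow_eq_one _).1 hl)⟩, p), rfl⟩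

theorem liftHom_injective : Function.Injective M.liftHom := by
  refine (injective_iff_map_eq_one _).2 ?_
  rintro ⟨l, p⟩ h
  obtain ⟨h1, h2⟩ := rot_mul_flow_eq_one (congrArg Subtype.val h)
  exact Prod.ext (Subtype.ext h1) h2

theorem flow_injective : Function.Injective M.flow := fun p q h => by
  have h1 : M.liftHom (1, p) = M.liftHom (1, q) :=
    Subtype.ext (by rw [coe_liftHom_one, coe_liftHom_one, h])
  exact congrArg Prod.snd (M.liftHom_injective h1)

theorem lifts_mul_comm (σ ρ : M.lifts) : σ * ρ = ρ * σ := by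
  obtain ⟨q, rfl⟩ := M.liftHom_surjective σ
  obtain ⟨r, rfl⟩ := M.liftHom_surjective ρ
  rw [← map_mul, mul_comm, map_mul]

/-- The map `(s, c) ↦ (exp (2 π i s), exp (2 π i (c - τ s)))`, with kernel the periods of the
action of `ℂ × ℂ` on `(U, C)`. -/
def expHom : Multiplicative (ℂ × ℂ) →* ℂˣ × ℂˣ where
  toFun p := (Units.mk0 (Complex.exp (2 * Real.pi * Complex.I * p.toAdd.1)) (Complex.exp_ne_zero _),
    Units.mk0 (Complex.exp (2 * Real.pi * Complex.I * (p.toAdd.2 - M.τ * p.toAdd.1)))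
      (Complex.exp_ne_zero _))
  map_one' := by
    ext <;> simp
  map_mul' p q := by
    ext
    · simp [mul_add, Complex.exp_add]
    · simp only [toAdd_mul, Prod.fst_add, Prod.snd_add, Prod.mk_mul_mk, Units.val_mul,
        Units.val_mk0, ← Complex.exp_add]
      ring_nf

theorem expHom_surjective : Function.Surjective M.expHom := by
  rintro ⟨u, v⟩
  have hpi := Complex.two_pi_I_ne_zero
  refine ⟨Multiplicative.ofAdd (Complex.log u / (2 * Real.pi * Complex.I),
    Complex.log v / (2 * Real.pi * Complex.I)
      + M.τ * (Complex.log u / (2 * Real.pi * Complex.I))), ?_⟩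
  refine Prod.ext (Units.ext ?_) (Units.ext ?_)
  · change Complex.exp (2 * Real.pi * Complex.I * (Complex.log u / (2 * Real.pi * Complex.I))) = u
    rw [mul_div_cancel₀ _ hpi, Complex.exp_log u.ne_zero]
  · change Complex.exp (2 * Real.pi * Complex.I * (_ + _ - _)) = v
    simp only [toAdd_ofAdd]
    rw [add_sub_cancel_right, mul_div_cancel₀ _ hpi, Complex.exp_log v.ne_zero]

theorem expHom_eq_one_iff {s c : ℂ} : M.expHom (Multiplicative.ofAdd (s, c)) = 1 ↔
    ∃ a b : ℤ, s = b ∧ c = a + b * M.τ := by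
  have h : M.expHom (Multiplicative.ofAdd (s, c)) = 1 ↔
      Complex.exp (2 * Real.pi * Complex.I * s) = 1 ∧
        Complex.exp (2 * Real.pi * Complex.I * (c - M.τ * s)) = 1 := by
    rw [Prod.ext_iff, Units.ext_iff, Units.ext_iff]
    rfl
  have hpi := Complex.two_pi_I_ne_zero
  rw [h, Complex.exp_eq_one_iff, Complex.exp_eq_one_iff]
  constructor
  · rintro ⟨⟨b, hb⟩, a, ha⟩
    rw [mul_comm] at hb ha
    have hb' := mul_right_cancel₀ hpi hb
    have ha' := mul_right_cancel₀ hpi ha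
    exact ⟨a, b, hb', by rw [← hb']; linear_combination ha'⟩
  · rintro ⟨a, b, rfl, rfl⟩
    exact ⟨⟨b, by ring⟩, a, by ring⟩

/-- The automorphism of `(U, C)` attached to a root of unity `l` and to `p ∈ ℂ × ℂ`. -/
def autHom : rootsOfUnity M.symmetryOrder ℂ × Multiplicative (ℂ × ℂ) →* M.Aut :=
  (QuotientGroup.mk' _).comp M.liftHom

/-- By injectivity of `liftHom`, a lift is a deck transformation only if `l = 1` and `(s, c)` lies
in the period lattice, which is the kernel of `expHom`. -/
theorem ker_autHom :
    M.autHom.ker = ((MonoidHom.id (rootsOfUnity M.symmetryOrder ℂ)).prodMap M.expHom).ker := by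
  ext ⟨l, p⟩
  obtain ⟨⟨s, c⟩, rfl⟩ := Multiplicative.ofAdd.surjective p
  have h1 : M.autHom (l, Multiplicative.ofAdd (s, c)) = 1 ↔
      rot l * M.flow (Multiplicative.ofAdd (s, c)) ∈ M.deckGroup := by
    change (QuotientGroup.mk (M.liftHom _) : M.Aut) = 1 ↔ _
    rw [QuotientGroup.eq_one_iff, Subgroup.mem_subgroupOf, coe_liftHom]
  have h2 : ((MonoidHom.id (rootsOfUnity M.symmetryOrder ℂ)).prodMap M.expHom)
      (l, Multiplicative.ofAdd (s, c)) = 1 ↔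
        l = 1 ∧ M.expHom (Multiplicative.ofAdd (s, c)) = 1 := Prod.ext_iff
  rw [MonoidHom.mem_ker, MonoidHom.mem_ker, h1, h2, mem_deckGroup_iff, expHom_eq_one_iff]
  constructor
  · rintro ⟨a, b, h⟩
    rw [← coe_liftHom, ← coe_liftHom_one] at h
    have h3 := M.liftHom_injective (Subtype.ext h)
    have h4 := congrArg (fun q => Multiplicative.toAdd q.2) h3
    exact ⟨congrArg Prod.fst h3, a, b, congrArg Prod.fst h4, congrArg Prod.snd h4⟩
  · rintro ⟨rfl, a, b, rfl, rfl⟩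
    exact ⟨a, b, by rw [← coe_liftHom, coe_liftHom_one]⟩

/-- The formula on `autHom (1, p)` is kept with `e` because it identifies the one-parameter
subgroups of the torus factor with flows. -/
theorem exists_autEquiv : ∃ e : M.Aut ≃* Multiplicative (ZMod M.symmetryOrder) × (ℂˣ × ℂˣ),
    ∀ p, e (M.autHom (1, p)) = (1, M.expHom p) := by
  have : NeZero M.symmetryOrder := ⟨M.symmetryOrder_pos.ne'⟩
  have hcard : Nat.card (rootsOfUnity M.symmetryOrder ℂ)
      = Nat.card (Multiplicative (ZMod M.symmetryOrder)) := by
    rw [Complex.card_rootsOfUnity]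
    exact (Nat.card_zmod _).symm
  obtain ⟨e, he⟩ := exists_mulEquiv_of_ker_eq M.autHom
    ((MonoidHom.id (rootsOfUnity M.symmetryOrder ℂ)).prodMap M.expHom)
    ((QuotientGroup.mk'_surjective _).comp M.liftHom_surjective)
    (Function.surjective_id.prodMap M.expHom_surjective) M.ker_autHom
  refine ⟨e.trans (MulEquiv.prodCongr (mulEquivOfCyclicCardEq hcard) (MulEquiv.refl _)), fun p => ?_⟩
  rw [MulEquiv.trans_apply, he]
  exact Prod.ext (map_one (mulEquivOfCyclicCardEq hcard)) rfl

/-! ### One-parameter subgroups -/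

theorem hasDerivAt_flow (s c : ℂ) (f : FormalFun) (n : ℕ) (x : ℂ) :
    HasDerivAt (fun t : ℂ => cf n (M.flow (Multiplicative.ofAdd (t * s, t * c)) f) x)
      (cf n ((s • M.v₀ + c • partialX) f) x) 0 := by
  -- The translation is moved outside so that it becomes evaluation at `x + t c`. The terms with a
  -- factor `t ^ 2` or higher do not contribute to the derivative at 0.
  have h1 : ∀ t : ℂ, cf n (M.flow (Multiplicative.ofAdd (t * s, t * c)) f) x
      = (∑ m ∈ Finset.range n, (t * s) ^ (m + 1 + 1) * (((m + 1 + 1).factorial : ℂ)⁻¹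
          * cf n ((M.v₀)^[m + 1 + 1] f) (x + t * c)))
        + t * s * cf n (M.v₀ f) (x + t * c) + cf n f (x + t * c) := by
    intro t
    rw [flow_apply, ← shift_lieSeries, cf_shift,
      M.v₀_raisesOrder.cf_lieSeries_smul (show n < n + 1 + 1 by omega), Finset.sum_range_succ',
      Finset.sum_range_succ']
    simp
  have hline : HasDerivAt (fun t : ℂ => x + t * c) c 0 := by
    simpa using ((hasDerivAt_id (0 : ℂ)).mul_const c).const_add x
  have hcomp : ∀ g : FormalFun,
      HasDerivAt (fun t : ℂ => cf n g (x + t * c)) (deriv (cf n g) x * c) 0 := by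
    intro g
    have h2 : HasDerivAt (cf n g) (deriv (cf n g) x) (x + 0 * c) := by
      rw [zero_mul, add_zero]
      exact (differentiable_cf n g x).hasDerivAt
    exact h2.comp (0 : ℂ) hline
  have hts : HasDerivAt (fun t : ℂ => t * s) s 0 := by
    simpa using (hasDerivAt_id (0 : ℂ)).mul_const s
  have h3 : ∀ m ∈ Finset.range n, HasDerivAt (fun t : ℂ => (t * s) ^ (m + 1 + 1)
      * (((m + 1 + 1).factorial : ℂ)⁻¹ * cf n ((M.v₀)^[m + 1 + 1] f) (x + t * c))) 0 0 := by
    intro m _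
    have h4 := (hts.fun_pow (m + 1 + 1)).fun_mul ((hcomp ((M.v₀)^[m + 1 + 1] f)).const_mul
      (((m + 1 + 1).factorial : ℂ)⁻¹))
    simpa using h4
  have h5 := ((HasDerivAt.fun_sum h3).add (hts.mul (hcomp (M.v₀ f)))).add (hcomp f)
  refine (h5.congr_deriv ?_).congr_of_eventuallyEq (Filter.Eventually.of_forall h1)
  rw [Derivation.add_apply, Derivation.smul_apply, Derivation.smul_apply, cf_add, cf_smul, cf_smul,
    cf_partialX]
  simp
  ring

theorem isFlowOf_autHom (s c : ℂ) :
    M.IsFlowOf (fun t => M.autHom (1, Multiplicative.ofAdd (t * s, t * c)))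
      (s • M.v₀ + c • partialX) := by
  let θ : Multiplicative ℂ →* M.lifts := M.liftHom.comp
    ((MonoidHom.inr _ _).comp (AddMonoidHom.toMultiplicative
      ((AddMonoidHom.mulRight s).prod (AddMonoidHom.mulRight c))))
  have hθ : ∀ t : ℂ, θ (Multiplicative.ofAdd t)
      = M.liftHom (1, Multiplicative.ofAdd (t * s, t * c)) := fun _ => rfl
  refine ⟨θ, fun t => rfl, fun f n x => ?_⟩
  simp only [hθ, coe_liftHom_one]
  exact M.hasDerivAt_flow s c f n x

/-- The group of deck transformations contains no nontrivial divisible subgroup. -/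
theorem eq_one_of_forall_exists_pow {σ : FormalFun ≃ₐ[ℂ] FormalFun} (hσ : σ ∈ M.deckGroup)
    (h : ∀ N : ℕ, 0 < N → ∃ ρ ∈ M.deckGroup, ρ ^ N = σ) : σ = 1 := by
  obtain ⟨a, b, rfl⟩ := M.mem_deckGroup_iff.1 hσ
  have hdvd : ∀ N : ℕ, 0 < N → (N : ℤ) ∣ a ∧ (N : ℤ) ∣ b := by
    intro N hN
    obtain ⟨ρ, hρ, hpow⟩ := h N hN
    obtain ⟨a', b', rfl⟩ := M.mem_deckGroup_iff.1 hρ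
    rw [← map_pow, ← ofAdd_nsmul] at hpow
    have h1 := congrArg Multiplicative.toAdd (M.flow_injective hpow)
    have hb := congrArg Prod.fst h1
    have ha := congrArg Prod.snd h1
    simp only [toAdd_ofAdd, Prod.smul_mk, nsmul_eq_mul] at ha hb
    obtain ⟨ha', hb'⟩ := int_add_int_mul_τ_inj (M := M) (a := N * a') (b := N * b') (a' := a)
      (b' := b) (by push_cast; rw [← ha]; ring)
    exact ⟨⟨a', ha'.symm⟩, ⟨b', hb'.symm⟩⟩
  -- An integer divisible by `|z| + 1` and equal to `z` must be zero.
  have hzero : ∀ z : ℤ, (∀ N : ℕ, 0 < N → (N : ℤ) ∣ z) → z = 0 := fun z hz =>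
    Int.eq_zero_of_abs_lt_dvd (hz (z.natAbs + 1) (Nat.succ_pos _)) (by
      rw [Int.abs_eq_natAbs]; push_cast; omega)
  rw [hzero a fun N hN => (hdvd N hN).1, hzero b fun N hN => (hdvd N hN).2]
  simp only [Int.cast_zero, zero_mul, add_zero]
  exact M.flow.map_one

variable {M}

/-- Since the group of lifts is commutative, the quotient of the two lifted flows is a homomorphism
from ℂ to the deck group. Its values are divisible by every `N`, so it is trivial and the two
derivatives at 0 coincide. -/
theorem IsFlowOf.unique {γ : ℂ → M.Aut} {D D' : Derivation ℂ FormalFun FormalFun}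
    (h : M.IsFlowOf γ D) (h' : M.IsFlowOf γ D') : D = D' := by
  obtain ⟨θ, hθ, hD⟩ := h
  obtain ⟨θ', hθ', hD'⟩ := h'
  let δ : Multiplicative ℂ →* M.lifts :=
    { toFun := fun t => (θ t)⁻¹ * θ' t
      map_one' := by simp
      map_mul' := fun t u => by
        rw [map_mul, map_mul, mul_inv_rev, M.lifts_mul_comm (θ u)⁻¹, mul_assoc, mul_assoc,
          ← mul_assoc (θ u)⁻¹, M.lifts_mul_comm (θ u)⁻¹ (θ' t), mul_assoc] }
  have hmem : ∀ t, (δ t : FormalFun ≃ₐ[ℂ] FormalFun) ∈ M.deckGroup := fun t => by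
    have h1 : (QuotientGroup.mk (θ t) : M.Aut) = QuotientGroup.mk (θ' t) :=
      (hθ t.toAdd).trans (hθ' t.toAdd).symm
    exact Subgroup.mem_subgroupOf.1 (QuotientGroup.eq.1 h1)
  have hδ : ∀ t, θ' t = θ t := by
    intro t
    have h1 : (δ t : FormalFun ≃ₐ[ℂ] FormalFun) = 1 := by
      refine M.eq_one_of_forall_exists_pow (hmem t) fun N hN =>
        ⟨δ (Multiplicative.ofAdd (t.toAdd / N)), hmem _, ?_⟩
      rw [← Subgroup.coe_pow, ← map_pow, ← ofAdd_nsmul, nsmul_eq_mul,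
        mul_div_cancel₀ _ (Nat.cast_ne_zero.2 hN.ne'), ofAdd_toAdd]
    have h2 : (θ t)⁻¹ * θ' t = 1 := Subtype.ext h1
    exact (inv_mul_eq_one.1 h2).symm
  ext1 f
  refine ext_cf fun n x => ?_
  have h1 := hD' f n x
  simp only [hδ] at h1
  exact (hD f n x).unique h1

/-- The linear change `(s, c) ↦ 2 π i (s, c - τ s)` is the differential of `expHom`; it is
invertible, so every `(a, b)` arises this way. -/
theorem symm_oneParam {e : M.Aut ≃* Multiplicative (ZMod M.symmetryOrder) × (ℂˣ × ℂˣ)}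
    (he : ∀ p, e (M.autHom (1, p)) = (1, M.expHom p)) (s c t : ℂ) :
    e.symm (1, oneParam (2 * Real.pi * Complex.I * s) (2 * Real.pi * Complex.I * (c - M.τ * s)) t)
      = M.autHom (1, Multiplicative.ofAdd (t * s, t * c)) := by
  rw [MulEquiv.symm_apply_eq, he]
  refine Prod.ext rfl (Prod.ext (Units.ext ?_) (Units.ext ?_))
  · change Complex.exp (2 * Real.pi * Complex.I * s * t)
      = Complex.exp (2 * Real.pi * Complex.I * (t * s))
    ring_nf
  · change Complex.exp (2 * Real.pi * Complex.I * (c - M.τ * s) * t)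
      = Complex.exp (2 * Real.pi * Complex.I * (t * c - M.τ * (t * s)))
    ring_nf

theorem isFlowOf_symm_oneParam
    {e : M.Aut ≃* Multiplicative (ZMod M.symmetryOrder) × (ℂˣ × ℂˣ)}
    (he : ∀ p, e (M.autHom (1, p)) = (1, M.expHom p)) (s c : ℂ) :
    M.IsFlowOf (fun t => e.symm (1, oneParam (2 * Real.pi * Complex.I * s)
      (2 * Real.pi * Complex.I * (c - M.τ * s)) t)) (s • M.v₀ + c • partialX) := by
  simp only [symm_oneParam he]
  exact M.isFlowOf_autHom s c

theorem exists_eq_two_pi_I_mul (M : NormalForm) (a b : ℂ) : ∃ s c : ℂ,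
    a = 2 * Real.pi * Complex.I * s ∧ b = 2 * Real.pi * Complex.I * (c - M.τ * s) := by
  have hpi := Complex.two_pi_I_ne_zero
  refine ⟨a / (2 * Real.pi * Complex.I), b / (2 * Real.pi * Complex.I)
    + M.τ * (a / (2 * Real.pi * Complex.I)), ?_, ?_⟩
  · rw [mul_div_cancel₀ _ hpi]
  · rw [add_sub_cancel_right, mul_div_cancel₀ _ hpi]

end NormalForm

end EllipticNbhd

end

/-! ### Proof of the theorem -/

open EllipticNbhd NormalForm in
theorem lemmaL (M : NormalForm) :
    (∀ g : M.Aut, M.Convergent g) ∧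
    M.symmetryOrder ∣ M.k ∧
    ∃ e : M.Aut ≃* Multiplicative (ZMod M.symmetryOrder) × (ℂˣ × ℂˣ),
      (∀ a b : ℂ, ∃! D : Derivation ℂ FormalFun FormalFun,
        M.IsFlowOf (fun t => e.symm (1, oneParam a b t)) D) ∧
      M.generators (e.symm.toMonoidHom.comp (MonoidHom.inr _ _)) =
        (Submodule.span ℂ {M.v₀, M.vInf} : Set (Derivation ℂ FormalFun FormalFun)) := by
  refine ⟨fun _ σ _ => convergentDiffeo_of_mem_lifts σ.2, M.symmetryOrder_dvd, ?_⟩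
  obtain ⟨e, he⟩ := M.exists_autEquiv
  refine ⟨e, fun a b => ?_, ?_⟩
  · obtain ⟨s, c, rfl, rfl⟩ := exists_eq_two_pi_I_mul M a b
    exact ⟨_, isFlowOf_symm_oneParam he s c, fun D hD =>
      hD.unique (isFlowOf_symm_oneParam he s c)⟩
  · ext D
    rw [SetLike.mem_coe, Submodule.mem_span_pair]
    constructor
    · rintro ⟨a, b, hD⟩
      obtain ⟨s, c, rfl, rfl⟩ := exists_eq_two_pi_I_mul M a b
      -- The division by τ converts a multiple of `∂_x` into a multiple of `v_∞ = τ ∂_x`.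
      refine ⟨s, c / M.τ, ?_⟩
      rw [vInf, smul_smul, div_mul_cancel₀ _ M.τ_ne_zero]
      exact (isFlowOf_symm_oneParam he s c).unique hD
    · rintro ⟨s, c, rfl⟩
      rw [vInf, smul_smul]
      exact ⟨_, _, isFlowOf_symm_oneParam he s (c * M.τ)⟩
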